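/- Let $(X,d)$ be a metric space and let $\mathfrak m$ be a Borel regular measure on $X$, i.e. Borel sets are measurable and every measurable set is contained in a Borel set of the same measure. Let $f\colon X\to[-\infty,\infty]$ and $g\colon X\to[0,\infty]$ be measurable functions that are finite $\mathfrak m$-almost everywhere. Then: (a) If $\mathfrak m$ is $\sigma$-finite and $g$ is a Hajłasz gradient of $f$, then there are Borel functions $f'\colon X\to\mathbb R$ and $g'\colon X\to[0,\infty]$ such that $f=f'$ and $g=g'$ $\mathfrak m$-almost everywhere and $76\,g'$ is an $\mathfrak m$-upper S-gradient of $f'$. (b) If $\mathfrak m$ is doubling and $f,g\in L^1_{\mathrm{loc}}(\mathfrak m)$ are Borel functions such that $g$ is an $\mathfrak m$-upper S-gradient of $f$, then $g/2$ is a Hajłasz gradient of $f$. Here the following conventions and definitions are used. We put $|\infty-\infty|=|(-\infty)-(-\infty)|=\infty$. The measure $\mathfrak m$ is doubling if $0<\mathfrak m(B(x,r))<\infty$ for all $x\in X$, $r>0$ and there is a constant $C$ with $\mathfrak m(B(x,2r))\le C\,\mathfrak m(B(x,r))$ for all $x\in X$, $r>0$. A function $h$ is in $L^1_{\mathrm{loc}}(\mathfrak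 m)$ if it is measurable and every point of $X$ has a neighbourhood $U$ with $\int_U|h|\,d\mathfrak m<\infty$. Hajłasz gradients. A measurable $g\colon X\to[0,\infty]$ is a Hajłasz gradient of a measurable, $\mathfrak m$-a.e. finite function $f$ if there is a measurable set $E$ with $\mathfrak m(E)=0$ and $|f(y)-f(x)|\le (g(x)+g(y))\,d(x,y)$ for all $x,y\in X\setminus E$. Test curves. $TC$ is the set of all functions $\gamma\colon[0,1]\to X$ of bounded variation that are right-continuous on $[0,1)$, left-continuous at $1$, and have a left limit $\gamma(t^-)\in X$ at every $t\in(0,1)$. It carries the metric $d_{TC}(\gamma,\gamma')=\int_0^1\min\{1,d(\gamma(t),\gamma'(t))\}\,dt$ and its Borel $\sigma$-algebra. $V(\gamma)$ denotes the total variation of $\gamma$ and $V_\gamma(t)=V(\gamma|_{[0,t]})$. The reversal of $\gamma\in TC$ is $\overleftarrow\gamma(t)=\gamma((1-t)^-)$, with $\gamma(0^-)=\gamma(0)$; it is again in $TC$. Symmetrized integral. For $\gamma\in TC$ let $\mu_\gamma$ be the Lebesgue–Stieltjes measure on $[0,1]$ with $\mu_\gamma((r,t])=V_\gamma(t)-V_\gamma(r)$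 for $r<t$ and $\mu_\gamma(\{0\})=0$. For Borel $g\colon X\to[0,\infty]$ put $\int_\gamma g=\int_{[0,1]}g\circ\gamma\,d\mu_\gamma$ and $\int^S_\gamma g=\tfrac12\bigl(\int_\gamma g+\int_{\overleftarrow\gamma}g\bigr)$. $\mathfrak m$-upper S-gradients. A Borel probability measure $P$ on $TC$ is $\mathfrak m$-admissible if there is a constant $C\ge 0$ such that $P(\{\gamma:\gamma(t)\in B\})\le C\,\mathfrak m(B)$ for all $t\in[0,1]$ and all Borel $B\subseteq X$, and $\int_{TC}V(\gamma)\,dP(\gamma)<\infty$. A Borel function $g\colon X\to[0,\infty]$ is an $\mathfrak m$-upper S-gradient of a Borel function $f\colon X\to[-\infty,\infty]$ if $$\int_{TC}|f(\gamma(1))-f(\gamma(0))|\,dP(\gamma)\le\int_{TC}\Bigl(\int^S_\gamma g\Bigr)dP(\gamma)$$ for every $\mathfrak m$-admissible $P$ with $P(\{\gamma: V(\gamma)=0\})=0$. -/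

import Mathlib

open MeasureTheory Set Filter Topology Function
open scoped ENNReal NNReal unitInterval

/-- A test curve `γ : [0,1] → X`: a right-continuous function of bounded variation that is
left-continuous at `1` and has a left limit in `X` at every point of `(0,1)`. -/
structure TestCurve (X : Type*) [MetricSpace X] where
  toFun : I → X
  boundedVariation : BoundedVariationOn toFun univ
  rightContinuous : ∀ t : I, ContinuousWithinAt toFun (Ici t) t
  leftContinuous_one : ContinuousWithinAt toFun (Iic 1) 1
  exists_leftLimit : ∀ t : I, 0 < t → t < 1 → ∃ y, Tendsto toFun (𝓝[<] t) (𝓝 y)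

namespace TestCurve

variable {X : Type*} [MetricSpace X]

instance : CoeFun (TestCurve X) (fun _ => I → X) := ⟨TestCurve.toFun⟩

theorem ext_fun {γ γ' : TestCurve X} (h : ∀ t, γ t = γ' t) : γ = γ' := by
  cases γ; cases γ'
  congr
  exact funext h

theorem tendsto_leftLim (γ : TestCurve X) (t : I) :
    Tendsto γ (𝓝[<] t) (𝓝 (leftLim γ t)) := by
  apply tendsto_leftLim_of_tendsto
  rcases eq_or_lt_of_le (unitInterval.nonneg' : 0 ≤ t) with h | h
  · subst h
    refine ⟨γ 0, ?_⟩
    have : Iio (0 : I) = ∅ := by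
      ext s
      simp only [mem_Iio, mem_empty_iff_false, iff_false, not_lt]
      exact unitInterval.nonneg'
    simp [this]
  rcases eq_or_lt_of_le (unitInterval.le_one' : t ≤ 1) with h1 | h1
  · subst h1
    exact ⟨γ 1, γ.leftContinuous_one.tendsto.mono_left (nhdsWithin_mono _ Iio_subset_Iic_self)⟩
  · exact γ.exists_leftLimit t h h1

theorem tendsto_leftLim_right (γ : TestCurve X) (t : I) :
    Tendsto (leftLim γ) (𝓝[>] t) (𝓝 (γ t)) := by
  have h : Tendsto γ (𝓝[>] t) (𝓝 (γ t)) :=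
    (γ.rightContinuous t).tendsto.mono_left (nhdsWithin_mono _ Ioi_subset_Ici_self)
  rcases eq_or_neBot (𝓝[>] t) with h' | h'
  · simp [h']
  apply (closed_nhds_basis (γ t)).tendsto_right_iff.2
  rintro s ⟨s_mem, s_closed⟩
  obtain ⟨b, hb⟩ : (Ioi t).Nonempty := Filter.nonempty_of_mem (self_mem_nhdsWithin (a := t))
  obtain ⟨u, au, hu⟩ : ∃ u, t < u ∧ Ioo t u ⊆ {x | γ x ∈ s} := by
    have := (closed_nhds_basis (γ t)).tendsto_right_iff.1 h s ⟨s_mem, s_closed⟩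
    simpa using (mem_nhdsGT_iff_exists_Ioo_subset' hb).1 this
  filter_upwards [Ioo_mem_nhdsGT au] with c hc
  rcases eq_or_neBot (𝓝[<] c) with h'c | h'c
  · simpa [h'c, leftLim_eq_of_eq_bot] using hu hc
  apply s_closed.mem_of_tendsto (γ.tendsto_leftLim c)
  filter_upwards [Ioo_mem_nhdsLT_of_mem ⟨hc.1, hc.2.le⟩] with d hd using hu hd

theorem leftLim_zero (γ : TestCurve X) : leftLim γ 0 = γ 0 :=
  leftLim_eq_of_isBot fun _ => unitInterval.nonneg'

theorem tendsto_symm_right (t : I) : Tendsto unitInterval.symm (𝓝[≥] t) (𝓝[≤] (unitInterval.symm t)) := by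
  refine tendsto_nhdsWithin_of_tendsto_nhds_of_eventually_within _
    (unitInterval.continuous_symm.continuousWithinAt) ?_
  filter_upwards [self_mem_nhdsWithin] with s hs
  exact unitInterval.strictAnti_symm.antitone hs

theorem tendsto_symm_left (t : I) : Tendsto unitInterval.symm (𝓝[<] t) (𝓝[>] (unitInterval.symm t)) := by
  refine tendsto_nhdsWithin_of_tendsto_nhds_of_eventually_within _
    (unitInterval.continuous_symm.continuousWithinAt) ?_
  filter_upwards [self_mem_nhdsWithin] with s hs
  exact unitInterval.strictAnti_symm hs

/-- The reversal of a test curve, `t ↦ γ((1 - t)⁻)`, where `γ(0⁻) = γ(0)`. -/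
noncomputable def reverse (γ : TestCurve X) : TestCurve X where
  toFun t := leftLim γ (unitInterval.symm t)
  boundedVariation :=
    ((eVariationOn.comp_le_of_antitoneOn (leftLim γ) unitInterval.symm (t := univ) (s := univ)
      (unitInterval.strictAnti_symm.antitone.antitoneOn _) (mapsTo_univ _ _)).trans_lt
      γ.boundedVariation.leftLim.lt_top).ne
  rightContinuous t :=
    (continuousWithinAt_leftLim_Iic (γ.tendsto_leftLim (unitInterval.symm t))).tendsto.comp
      (tendsto_symm_right t)
  leftContinuous_one := by
    rw [← continuousWithinAt_Iio_iff_Iic, ContinuousWithinAt, unitInterval.symm_one,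
      γ.leftLim_zero]
    have h := (γ.tendsto_leftLim_right (unitInterval.symm 1)).comp (tendsto_symm_left 1)
    rwa [unitInterval.symm_one] at h
  exists_leftLimit t _ _ :=
    ⟨_, (γ.tendsto_leftLim_right (unitInterval.symm t)).comp (tendsto_symm_left t)⟩

/-- The total variation `V(γ)`. -/
noncomputable def variation (γ : TestCurve X) : ℝ≥0∞ := eVariationOn γ univ

theorem variation_Iic_ne_top (γ : TestCurve X) (t : I) : eVariationOn γ (Iic t) ≠ ∞ :=
  γ.boundedVariation.mono (subset_univ _)

/-- The variation function `t ↦ V(γ|[0,t])`; it is monotone and right-continuous. -/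
noncomputable def variationFunction (γ : TestCurve X) : StieltjesFunction I where
  toFun t := (eVariationOn γ (Iic t)).toReal
  mono' s t hst := ENNReal.toReal_mono (γ.variation_Iic_ne_top t)
    (eVariationOn.mono _ (Iic_subset_Iic.2 hst))
  right_continuous' t := by
    refine (ENNReal.tendsto_toReal (γ.variation_Iic_ne_top t)).comp ?_
    have h := γ.boundedVariation.tendsto_eVariationOn_Icc_zero_right t
      (by simpa using γ.rightContinuous t)
    have h2 : Tendsto (fun y => eVariationOn γ (Iic t) + eVariationOn γ (Icc t y)) (𝓝[≥] t)
        (𝓝 (eVariationOn γ (Iic t) + 0)) := by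
      refine Tendsto.add tendsto_const_nhds ?_
      simpa using h.mono_left (nhdsWithin_mono t (subset_univ (Ici t)))
    rw [add_zero] at h2
    refine h2.congr' ?_
    filter_upwards [self_mem_nhdsWithin] with y hy
    have hty : t ≤ y := hy
    rw [← eVariationOn.union γ (x := t) isGreatest_Iic (isLeast_Icc hty), Iic_union_Icc_eq_Iic hty]

/-- The integral `∫_γ g` of a nonnegative function along a test curve: the integral of `g ∘ γ`
against the Lebesgue-Stieltjes measure of the variation function, which gives the mass
`V_γ(t) - V_γ(r)` to `(r,t]` and no mass to `{0}`. -/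
noncomputable def integral (γ : TestCurve X) (g : X → ℝ≥0∞) : ℝ≥0∞ :=
  ∫⁻ t, g (γ t) ∂γ.variationFunction.measure

/-- The symmetrized integral of a nonnegative function along a test curve. -/
noncomputable def symmIntegral (γ : TestCurve X) (g : X → ℝ≥0∞) : ℝ≥0∞ :=
  (γ.integral g + γ.reverse.integral g) / 2

theorem measurable_dist (γ γ' : TestCurve X) : Measurable fun t : I => dist (γ t) (γ' t) := by
  have hbv : BoundedVariationOn (fun t : I => dist (γ t) (γ' t)) univ := by
    refine ((iSup_le fun p => ?_ : _ ≤ eVariationOn γ univ + eVariationOn γ' univ).trans_lt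
      (ENNReal.add_lt_top.2 ⟨γ.boundedVariation.lt_top, γ'.boundedVariation.lt_top⟩)).ne
    refine le_trans ?_ (add_le_add
      (eVariationOn.sum_le (n := p.1) p.2.2.1 p.2.2.2)
      (eVariationOn.sum_le (n := p.1) p.2.2.1 p.2.2.2))
    rw [← Finset.sum_add_distrib]
    refine Finset.sum_le_sum fun i _ => ?_
    rw [edist_dist, edist_dist, edist_dist, ← ENNReal.ofReal_add dist_nonneg dist_nonneg]
    exact ENNReal.ofReal_le_ofReal (dist_dist_dist_le _ _ _ _)
  obtain ⟨p, q, hp, hq, hpq⟩ :=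
    hbv.locallyBoundedVariationOn.exists_monotoneOn_sub_monotoneOn
  rw [hpq]
  exact (monotoneOn_univ.1 hp).measurable.sub (monotoneOn_univ.1 hq).measurable

theorem integrable_min_dist (γ γ' : TestCurve X) :
    Integrable fun t : I => min 1 (dist (γ t) (γ' t)) := by
  refine Integrable.of_bound (C := 1)
    (measurable_const.min (measurable_dist γ γ')).aestronglyMeasurable
    (ae_of_all _ fun t => ?_)
  rw [Real.norm_of_nonneg (le_min zero_le_one dist_nonneg)]
  exact min_le_left _ _

theorem eq_of_integral_min_dist_eq_zero {γ γ' : TestCurve X}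
    (h : ∫ t : I, min 1 (dist (γ t) (γ' t)) = 0) : γ = γ' := by
  rw [integral_eq_zero_iff_of_nonneg (fun t => le_min zero_le_one dist_nonneg)
    (integrable_min_dist γ γ')] at h
  have hae : ∀ᵐ t : I, γ t = γ' t := by
    filter_upwards [h] with t ht
    have ht' : min 1 (dist (γ t) (γ' t)) = 0 := ht
    by_contra hne
    exact absurd ht' (lt_min one_pos (dist_pos.2 hne)).ne'
  have hd : ∀ u v : I, u < v → ∃ s ∈ Ioo u v, γ s = γ' s := by
    intro u v huv
    have hpos : volume (Ioo u v) ≠ 0 := by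
      rw [unitInterval.volume_Ioo]
      exact (ENNReal.ofReal_pos.2 (sub_pos.2 huv)).ne'
    by_contra! hno
    exact hpos (measure_mono_null (fun s hs => hno s hs) hae)
  have key : ∀ (t : I) (l : Filter I), l.NeBot → (∀ U ∈ l, ∃ s ∈ U, γ s = γ' s) →
      Tendsto γ l (𝓝 (γ t)) → Tendsto γ' l (𝓝 (γ' t)) → γ t = γ' t := by
    intro t l _ hl h1 h2
    by_contra hne
    have h3 := (h1.dist h2).eventually (lt_mem_nhds (dist_pos.2 hne))
    obtain ⟨s, hs, hs'⟩ := hl _ h3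
    have : 0 < dist (γ s) (γ' s) := hs
    simp [hs'] at this
  refine ext_fun fun t => ?_
  rcases eq_or_lt_of_le (unitInterval.le_one' : t ≤ 1) with h1 | h1
  · subst h1
    refine key 1 (𝓝[<] 1) ?_ ?_
      (γ.leftContinuous_one.tendsto.mono_left (nhdsWithin_mono _ Iio_subset_Iic_self))
      (γ'.leftContinuous_one.tendsto.mono_left (nhdsWithin_mono _ Iio_subset_Iic_self))
    · exact nhdsLT_neBot_of_exists_lt ⟨0, zero_lt_one⟩
    · intro U hU
      obtain ⟨u, hu, hU⟩ := (mem_nhdsLT_iff_exists_Ioo_subset' (zero_lt_one (α := I))).1 hU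
      obtain ⟨s, hs, hs'⟩ := hd _ _ hu
      exact ⟨s, hU hs, hs'⟩
  · refine key t (𝓝[>] t) ?_ ?_
      ((γ.rightContinuous t).tendsto.mono_left (nhdsWithin_mono _ Ioi_subset_Ici_self))
      ((γ'.rightContinuous t).tendsto.mono_left (nhdsWithin_mono _ Ioi_subset_Ici_self))
    · exact nhdsGT_neBot_of_exists_gt ⟨1, h1⟩
    · intro U hU
      obtain ⟨u, hu, hU⟩ := (mem_nhdsGT_iff_exists_Ioo_subset' h1).1 hU
      obtain ⟨s, hs, hs'⟩ := hd _ _ hu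
      exact ⟨s, hU hs, hs'⟩

/-- The metric `d(γ, γ') = ∫₀¹ min(1, d(γ(t), γ'(t))) dt` of convergence in Lebesgue measure. -/
noncomputable instance : MetricSpace (TestCurve X) where
  dist γ γ' := ∫ t : I, min 1 (dist (γ t) (γ' t))
  dist_self γ := by simp
  dist_comm γ γ' := by simp only [dist_comm]
  dist_triangle γ₁ γ₂ γ₃ := by
    rw [← integral_add (integrable_min_dist _ _) (integrable_min_dist _ _)]
    refine integral_mono (integrable_min_dist _ _)
      ((integrable_min_dist _ _).add (integrable_min_dist _ _)) fun t => ?_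
    have h := dist_triangle (γ₁ t) (γ₂ t) (γ₃ t)
    have h1 : 0 ≤ dist (γ₁ t) (γ₂ t) := dist_nonneg
    have h2 : 0 ≤ dist (γ₂ t) (γ₃ t) := dist_nonneg
    simp only [min_def]
    split_ifs <;> linarith
  eq_of_dist_eq_zero h := eq_of_integral_min_dist_eq_zero h

noncomputable instance : MeasurableSpace (TestCurve X) := borel _

instance : BorelSpace (TestCurve X) := ⟨rfl⟩

end TestCurve

/-- `μ` is Borel regular: every measurable set is contained in a Borel set of the same measure.
The σ-algebra on which `μ` is defined may be larger than the Borel σ-algebra. -/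
def IsBorelRegular {X : Type*} [TopologicalSpace X] [MeasurableSpace X] (μ : Measure X) : Prop :=
  ∀ A, MeasurableSet A → ∃ B, MeasurableSet[borel X] B ∧ A ⊆ B ∧ μ B = μ A

/-- `μ` is doubling: balls have positive finite measure, and doubling the radius of a ball increases
its measure at most by a constant factor. -/
def IsDoublingMeasure {X : Type*} [MetricSpace X] [MeasurableSpace X] (μ : Measure X) : Prop :=
  (∀ x : X, ∀ r > 0, 0 < μ (Metric.ball x r) ∧ μ (Metric.ball x r) < ∞) ∧
    ∃ C : ℝ≥0, ∀ x : X, ∀ r > 0, μ (Metric.ball x (2 * r)) ≤ C * μ (Metric.ball x r)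

/-- Local integrability of a nonnegative function: every point has a neighbourhood over which the
integral is finite. -/
def HasLocallyFiniteIntegral {X : Type*} [TopologicalSpace X] [MeasurableSpace X]
    (μ : Measure X) (h : X → ℝ≥0∞) : Prop :=
  ∀ x : X, ∃ U ∈ 𝓝 x, ∫⁻ y in U, h y ∂μ < ∞

/-- The absolute difference of extended reals, with `|∞ - ∞| = |(-∞) - (-∞)| = ∞`. -/
noncomputable def absDiff (a b : EReal) : ℝ≥0∞ := (a - b).abs

theorem absDiff_top_top : absDiff ⊤ ⊤ = ∞ := by simp [absDiff]

theorem absDiff_bot_bot : absDiff ⊥ ⊥ = ∞ := by simp [absDiff]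

theorem absDiff_coe (a b : ℝ) : absDiff a b = ENNReal.ofReal |a - b| := by
  rw [absDiff, ← EReal.coe_sub, EReal.abs_def]

/-- A Borel probability measure `P` on test curves is `μ`-admissible if its time marginals
`(e_t)_# P` are bounded by a common multiple of `μ` on Borel sets and the variation is
`P`-integrable. -/
def IsAdmissible {X : Type*} [MetricSpace X] [MeasurableSpace X] (μ : Measure X)
    (P : Measure (TestCurve X)) : Prop :=
  IsProbabilityMeasure P ∧
    (∃ C : ℝ≥0, ∀ t : I, ∀ B : Set X, MeasurableSet[borel X] B →
      P {γ | γ t ∈ B} ≤ C * μ B) ∧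
    ∫⁻ γ, γ.variation ∂P < ∞

/-- `g` is a `μ`-upper S-gradient of `f`: both are Borel, and the integrated upper gradient
inequality holds for all admissible measures that are concentrated on the test curves of
positive variation. -/
def IsMeasureUpperSGradient {X : Type*} [MetricSpace X] [MeasurableSpace X] (μ : Measure X)
    (f : X → EReal) (g : X → ℝ≥0∞) : Prop :=
  Measurable[borel X] f ∧ Measurable[borel X] g ∧
    ∀ P : Measure (TestCurve X), IsAdmissible μ P → P {γ | γ.variation = 0} = 0 →
      ∫⁻ γ, absDiff (f (γ 1)) (f (γ 0)) ∂P ≤ ∫⁻ γ, γ.symmIntegral g ∂P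

/-- `g` is a Hajłasz gradient of `f`. -/
def IsHajlaszGradient {X : Type*} [MetricSpace X] [MeasurableSpace X] (μ : Measure X)
    (f : X → EReal) (g : X → ℝ≥0∞) : Prop :=
  Measurable f ∧ (∀ᵐ x ∂μ, f x ≠ ⊤ ∧ f x ≠ ⊥) ∧ Measurable g ∧
    ∃ E : Set X, MeasurableSet E ∧ μ E = 0 ∧
      ∀ x ∉ E, ∀ y ∉ E, absDiff (f y) (f x) ≤ (g x + g y) * edist x y

/-! For (a), change `f` and `g` on a Borel null set `B`, putting `g = ∞` there, so that the Hajłasz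
inequality holds at all pairs of points. Bounded compression of an admissible `P` keeps the end
points of almost every curve outside `B`, so it suffices to bound the increment of `f` along one
curve whose end points have finite `g`. Parametrize the curve by its variation. A jump from `γ(t⁻)`
to `γ(t)` becomes an interval whose length is the size of the jump, and `f` is interpolated linearly
on it. This gives `F` on `(0, L]`, with `L = V(γ)`, and `G = g(γ(t⁻)) + g(γ(t))` satisfying a
Hajłasz inequality on the real line. Reversal turns left limits into values, so `∫ G` is exactly
twice the symmetrized integral (`two_mul_symmIntegral`). On the line, chaining through points where
`G` is at most its local average gives `|F₁ - F₀| ≤ 6 ∫ G` (`edist_le_six_mul_lintegral`), hence the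
constant 12, which is below 76.

For (b), test the S-gradient inequality with random jumps. A curve with a single jump from `u` to
`v` has symmetrized integral `(g u + g v) / 2 * d(u, v)` (`symmIntegral_jump`). Choose `u` and `v`
independently and uniformly in small disjoint balls about `x` and `y`. The law is admissible because
normalized restrictions of the measure are bounded by multiples of it. Letting the radius tend to 0
at Lebesgue points of `f` and `g`, which are almost all points by doubling, gives the Hajłasz
inequality with `g / 2`. -/

namespace TestCurve

/-! ### Variation, left limits and reversal of test curves -/

variable {X : Type*} [MetricSpace X] (γ : TestCurve X)

theorem leftLim_one : leftLim γ 1 = γ 1 :=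
  haveI : (𝓝[<] (1 : I)).NeBot := nhdsLT_neBot_of_exists_lt ⟨0, zero_lt_one⟩
  leftLim_eq_of_tendsto
    (γ.leftContinuous_one.tendsto.mono_left (nhdsWithin_mono _ Iio_subset_Iic_self))

theorem rightLim_leftLim : rightLim (leftLim γ) = γ := by
  ext t
  rcases eq_or_lt_of_le (unitInterval.le_one' : t ≤ 1) with h1 | h1
  · subst h1
    rw [rightLim_eq_of_isTop (fun _ => unitInterval.le_one'), leftLim_one]
  · have : (𝓝[>] t).NeBot := nhdsGT_neBot_of_exists_gt ⟨1, h1⟩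
    exact rightLim_eq_of_tendsto (γ.tendsto_leftLim_right t)

/-- On an open set, passing to left or right limits cannot increase the variation. Since `γ` is
recovered from its left limits by right limits, both inequalities hold. -/
theorem eVariationOn_leftLim_Ioi (t : I) :
    eVariationOn (leftLim γ) (Ioi t) = eVariationOn γ (Ioi t) := by
  refine le_antisymm (eVariationOn.eVariationOn_leftLim_le isOpen_Ioi) ?_
  conv_lhs => rw [← γ.rightLim_leftLim]
  exact eVariationOn.eVariationOn_rightLim_le isOpen_Ioi

theorem eVariationOn_Iic_eq (t : I) :
    eVariationOn γ (Iic t) = eVariationOn γ (Iio t) + edist (γ t) (leftLim γ t) := by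
  rcases eq_or_lt_of_le (unitInterval.nonneg' : 0 ≤ t) with h | h
  · subst h
    have h1 : Iic (0 : I) = {0} := by
      ext s; exact ⟨fun hs => le_antisymm hs unitInterval.nonneg', fun hs => hs.le⟩
    rw [γ.leftLim_zero, edist_self, add_zero, h1, eVariationOn.subsingleton _ subsingleton_singleton]
    simp
  · have hb : (𝓝[<] t).NeBot := nhdsLT_neBot_of_exists_lt ⟨0, h⟩
    simpa using eVariationOn.eVariationOn_on_inter_Iic_eq_Iio_add_edist (f := γ) (s := univ)
      (a := t) (l := leftLim γ t) (by simpa using hb) (mem_univ _)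
      (by simpa using γ.tendsto_leftLim t)

theorem eVariationOn_leftLim_Ici_eq (t : I) :
    eVariationOn (leftLim γ) (Ici t) = eVariationOn γ (Ioi t) + edist (γ t) (leftLim γ t) := by
  rw [← eVariationOn_leftLim_Ioi]
  rcases eq_or_lt_of_le (unitInterval.le_one' : t ≤ 1) with h | h
  · subst h
    have h1 : Ici (1 : I) = {1} := by
      ext s; exact ⟨fun hs => le_antisymm unitInterval.le_one' hs, fun hs => hs.ge⟩
    rw [γ.leftLim_one, edist_self, add_zero, h1, eVariationOn.subsingleton _ subsingleton_singleton]
    refine (eVariationOn.subsingleton _ fun s hs => ?_).symm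
    exact absurd (hs : 1 < s) (not_lt.2 unitInterval.le_one')
  · have hb : (𝓝[>] t).NeBot := nhdsGT_neBot_of_exists_gt ⟨1, h⟩
    rw [edist_comm]
    simpa using eVariationOn.eVariationOn_on_inter_Ici_eq_Ioi_add_edist (f := leftLim γ) (s := univ)
      (a := t) (l := γ t) (by simpa using hb) (mem_univ _)
      (by simpa using γ.tendsto_leftLim_right t)

theorem eVariationOn_Ici_eq (t : I) : eVariationOn γ (Ici t) = eVariationOn γ (Ioi t) := by
  rcases eq_or_lt_of_le (unitInterval.le_one' : t ≤ 1) with h | h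
  · subst h
    rw [eVariationOn.subsingleton _ fun s hs r hr => ?_, eVariationOn.subsingleton _ fun s hs => ?_]
    · exact absurd (hs : 1 < s) (not_lt.2 unitInterval.le_one')
    · exact (le_antisymm unitInterval.le_one' hs).trans (le_antisymm unitInterval.le_one' hr).symm
  · have hb : (𝓝[>] t).NeBot := nhdsGT_neBot_of_exists_gt ⟨1, h⟩
    simpa using (eVariationOn.eVariationOn_inter_Ioi_eq_inter_Ici_of_continuousWithinAt (f := γ)
      (s := univ) (a := t) (by simpa using hb) (by simpa using γ.rightContinuous t)).symm

/-- A jump at `t` is invisible on `[0, t)` but is seen by the left-limit function on `[t, 1]`, which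
starts at `γ(t⁻)`. This splitting yields the variation function of the reversed curve. -/
theorem variation_eq_Iio_add (t : I) :
    γ.variation = eVariationOn γ (Iio t) + eVariationOn (leftLim γ) (Ici t) := by
  rw [eVariationOn_leftLim_Ici_eq, ← eVariationOn_Ici_eq, add_comm (eVariationOn γ (Ici t)),
    ← add_assoc, ← eVariationOn_Iic_eq, ← eVariationOn.union γ isGreatest_Iic isLeast_Ici,
    Iic_union_Ici, variation]

theorem variation_Iio_ne_top (t : I) : eVariationOn γ (Iio t) ≠ ∞ :=
  γ.boundedVariation.mono (subset_univ _)

theorem variationFunction_apply (t : I) :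
    γ.variationFunction t = (eVariationOn γ (Iic t)).toReal := rfl

theorem variationFunction_one : γ.variationFunction 1 = γ.variation.toReal := by
  rw [variationFunction_apply, variation,
    show Iic (1 : I) = univ from eq_univ_of_forall fun _ => unitInterval.le_one']

theorem variationFunction_zero : γ.variationFunction 0 = 0 := by
  rw [variationFunction_apply, eVariationOn.subsingleton, ENNReal.toReal_zero]
  intro s hs r hr
  exact (le_antisymm hs unitInterval.nonneg').trans (le_antisymm hr unitInterval.nonneg').symm

theorem variationFunction_nonneg (t : I) : 0 ≤ γ.variationFunction t := ENNReal.toReal_nonneg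

theorem variationFunction_sub {s t : I} (h : s ≤ t) :
    ENNReal.ofReal (γ.variationFunction t - γ.variationFunction s) = eVariationOn γ (Icc s t) := by
  have h1 : eVariationOn γ (Iic t) = eVariationOn γ (Iic s) + eVariationOn γ (Icc s t) := by
    rw [← eVariationOn.union γ (x := s) isGreatest_Iic (isLeast_Icc h), Iic_union_Icc_eq_Iic h]
  rw [variationFunction_apply, variationFunction_apply, h1, ENNReal.toReal_add
    (γ.variation_Iic_ne_top s) (γ.boundedVariation.mono (subset_univ _)), add_sub_cancel_left,
    ENNReal.ofReal_toReal (γ.boundedVariation.mono (subset_univ _))]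

theorem dist_le_variationFunction_sub {s t : I} (h : s ≤ t) :
    dist (γ s) (γ t) ≤ γ.variationFunction t - γ.variationFunction s := by
  rw [dist_edist]
  refine ENNReal.toReal_le_of_le_ofReal (sub_nonneg.2 (γ.variationFunction.mono h)) ?_
  rw [γ.variationFunction_sub h]
  exact eVariationOn.edist_le _ (left_mem_Icc.2 h) (right_mem_Icc.2 h)

theorem leftLim_variationFunction (t : I) :
    leftLim γ.variationFunction t = (eVariationOn γ (Iio t)).toReal := by
  have hIic : γ.variationFunction t = (eVariationOn γ (Iio t)).toReal + dist (γ t) (leftLim γ t) := by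
    rw [variationFunction_apply, eVariationOn_Iic_eq, ENNReal.toReal_add (γ.variation_Iio_ne_top t)
      (edist_ne_top _ _), dist_edist]
  rcases eq_or_lt_of_le (unitInterval.nonneg' : 0 ≤ t) with h | h
  · subst h
    rw [leftLim_eq_of_isBot fun _ => unitInterval.nonneg', hIic, γ.leftLim_zero, dist_self, add_zero]
  have hb : (𝓝[<] t).NeBot := nhdsLT_neBot_of_exists_lt ⟨0, h⟩
  refine leftLim_eq_of_tendsto ?_
  -- As `y` increases to `t`, all that remains of the variation on `[y, t]` is the jump at `t`.
  have h1 : Tendsto (fun y => eVariationOn γ (Icc y t)) (𝓝[<] t) (𝓝 (edist (γ t) (leftLim γ t))) := by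
    simpa using γ.boundedVariation.tendsto_eVariationOn_Icc_left (x := t) (l := leftLim γ t)
      (by simpa using γ.tendsto_leftLim t) (mem_univ _)
  have h2 := (ENNReal.tendsto_toReal (edist_ne_top _ _)).comp h1
  rw [← dist_edist] at h2
  have h3 := (tendsto_const_nhds (x := γ.variationFunction t)).sub h2
  rw [show γ.variationFunction t - dist (γ t) (leftLim γ t) = (eVariationOn γ (Iio t)).toReal by
    rw [hIic]; ring] at h3
  refine h3.congr' ?_
  filter_upwards [self_mem_nhdsWithin] with y hy
  have hyt : y ≤ t := le_of_lt hy
  simp only [Function.comp]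
  rw [← γ.variationFunction_sub hyt, ENNReal.toReal_ofReal
    (sub_nonneg.2 (γ.variationFunction.mono hyt))]
  ring

theorem variationFunction_sub_leftLim (t : I) :
    γ.variationFunction t - leftLim γ.variationFunction t = dist (leftLim γ t) (γ t) := by
  rw [leftLim_variationFunction, variationFunction_apply, eVariationOn_Iic_eq, ENNReal.toReal_add
    (γ.variation_Iio_ne_top t) (edist_ne_top _ _), dist_comm, dist_edist]
  ring

theorem tendsto_leftLim_variationFunction (t : I) :
    Tendsto γ.variationFunction (𝓝[<] t) (𝓝 (leftLim γ.variationFunction t)) :=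
  γ.variationFunction.mono.tendsto_leftLim t

theorem dist_leftLim_le {s t : I} (h : s < t) :
    dist (γ s) (leftLim γ t) ≤ leftLim γ.variationFunction t - γ.variationFunction s := by
  have hb : (𝓝[<] t).NeBot := nhdsLT_neBot_of_exists_lt ⟨s, h⟩
  refine le_of_tendsto_of_tendsto (tendsto_const_nhds.dist (γ.tendsto_leftLim t))
    ((γ.tendsto_leftLim_variationFunction t).sub tendsto_const_nhds) ?_
  filter_upwards [Ioo_mem_nhdsLT h] with r hr
  exact γ.dist_le_variationFunction_sub hr.1.le

instance : IsFiniteMeasure γ.variationFunction.measure := by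
  refine γ.variationFunction.isFiniteMeasure_of_forall_abs_le (C := γ.variationFunction 1) fun t => ?_
  rw [abs_of_nonneg (γ.variationFunction_nonneg t)]
  exact γ.variationFunction.mono unitInterval.le_one'

theorem measure_variationFunction_Iic (t : I) :
    γ.variationFunction.measure (Iic t) = ENNReal.ofReal (γ.variationFunction t) := by
  rw [show Iic t = Icc 0 t by ext; simp, StieltjesFunction.measure_Icc,
    leftLim_eq_of_isBot fun _ => unitInterval.nonneg', variationFunction_zero, sub_zero]

theorem reverse_variationFunction (t : I) : γ.reverse.variationFunction t =
    γ.variationFunction 1 - leftLim γ.variationFunction (unitInterval.symm t) := by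
  have h1 : eVariationOn γ.reverse (Iic t) =
      eVariationOn (leftLim γ) (Ici (unitInterval.symm t)) := by
    have : Ici (unitInterval.symm t) = unitInterval.symm '' Iic t := by
      ext s
      refine ⟨fun hs => ⟨unitInterval.symm s, ?_, unitInterval.symm_symm s⟩, ?_⟩
      · have := unitInterval.strictAnti_symm.antitone (show unitInterval.symm t ≤ s from hs)
        rwa [unitInterval.symm_symm] at this
      · rintro ⟨r, hr, rfl⟩
        exact unitInterval.strictAnti_symm.antitone hr
    rw [this]
    exact eVariationOn.comp_eq_of_antitoneOn (leftLim γ) unitInterval.symm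
      (unitInterval.strictAnti_symm.antitone.antitoneOn _)
  have h2 := γ.variation_eq_Iio_add (unitInterval.symm t)
  have h3 : eVariationOn (leftLim γ) (Ici (unitInterval.symm t)) ≠ ∞ :=
    γ.boundedVariation.leftLim.mono (subset_univ _)
  rw [variationFunction_apply, h1, variationFunction_one, leftLim_variationFunction, h2,
    ENNReal.toReal_add (γ.variation_Iio_ne_top _) h3, add_sub_cancel_left]

/-- Both measures give `[0, t]` the mass that the variation measure of `γ` gives to `[1 - t, 1]`.
The left limit in the reversed variation function accounts for the atom at `1 - t`. -/
theorem reverse_measure : γ.reverse.variationFunction.measure =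
    γ.variationFunction.measure.map unitInterval.symm := by
  refine Measure.ext_of_Iic _ _ fun t => ?_
  rw [measure_variationFunction_Iic, reverse_variationFunction,
    Measure.map_apply unitInterval.continuous_symm.measurable measurableSet_Iic,
    ← StieltjesFunction.measure_Icc]
  congr 1
  ext s
  simp only [mem_Icc, mem_preimage, mem_Iic, unitInterval.le_one', and_true]
  exact unitInterval.symm_le_comm

/-- The distance of a function of bounded variation to a set is measurable. -/
theorem measurable_infDist_comp {h : I → X} (hbv : BoundedVariationOn h univ) (F : Set X) :
    Measurable fun t => Metric.infDist (h t) F := by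
  have hbv : BoundedVariationOn (fun t : I => Metric.infDist (h t) F) univ :=
    (Metric.lipschitz_infDist_pt F).comp_boundedVariationOn hbv
  obtain ⟨p, q, hp, hq, hpq⟩ :=
    hbv.locallyBoundedVariationOn.exists_monotoneOn_sub_monotoneOn
  rw [hpq]
  exact (monotoneOn_univ.1 hp).measurable.sub (monotoneOn_univ.1 hq).measurable

/-- No separability of `X` is needed: the distance to a closed set is Lipschitz, so its composition
with `h` is a real function of bounded variation, a difference of monotone functions. -/
theorem measurable_of_boundedVariationOn [MeasurableSpace X] [BorelSpace X] {h : I → X}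
    (hbv : BoundedVariationOn h univ) : Measurable h := by
  refine measurable_of_isClosed fun F hF => ?_
  rcases F.eq_empty_or_nonempty with rfl | hne
  · simp
  have : h ⁻¹' F = (fun t => Metric.infDist (h t) F) ⁻¹' {0} := by
    ext t
    simp [hF.mem_iff_infDist_zero hne]
  rw [this]
  exact measurable_infDist_comp hbv F (measurableSet_singleton 0)

theorem measurable_comp {g : X → ℝ≥0∞} (hg : Measurable[borel X] g) : Measurable fun t => g (γ t) :=
  letI := borel X
  haveI : BorelSpace X := ⟨rfl⟩
  hg.comp (measurable_of_boundedVariationOn γ.boundedVariation)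

theorem measurable_comp_leftLim {g : X → ℝ≥0∞} (hg : Measurable[borel X] g) :
    Measurable fun t => g (leftLim γ t) :=
  letI := borel X
  haveI : BorelSpace X := ⟨rfl⟩
  hg.comp (measurable_of_boundedVariationOn γ.boundedVariation.leftLim)

theorem integral_reverse {g : X → ℝ≥0∞} (hg : Measurable[borel X] g) :
    γ.reverse.integral g = ∫⁻ t, g (leftLim γ t) ∂γ.variationFunction.measure := by
  rw [integral, reverse_measure, lintegral_map (γ.reverse.measurable_comp hg)
    unitInterval.continuous_symm.measurable]
  refine lintegral_congr fun t => ?_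
  show g (leftLim γ (unitInterval.symm (unitInterval.symm t))) = _
  rw [unitInterval.symm_symm]

theorem two_mul_symmIntegral {g : X → ℝ≥0∞} (hg : Measurable[borel X] g) :
    2 * γ.symmIntegral g =
      ∫⁻ t, (g (leftLim γ t) + g (γ t)) ∂γ.variationFunction.measure := by
  rw [lintegral_add_right _ (γ.measurable_comp hg), ← γ.integral_reverse hg, symmIntegral,
    ENNReal.mul_div_cancel two_ne_zero ENNReal.ofNat_ne_top, add_comm]
  rfl

end TestCurve

/-! ### Hajłasz inequalities on an interval -/

/-- If `G` is a Hajłasz gradient of `F` on an interval, up to and including finite values at the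
end points, then the increment of `F` is controlled by the integral of `G`. -/
theorem edist_le_six_mul_lintegral {L : ℝ} (hL : 0 < L) {F : ℝ → ℝ} {G : ℝ → ℝ≥0∞}
    (hG : Measurable G) {F₀ F₁ : ℝ} {c₀ c₁ : ℝ≥0∞} (hc₀ : c₀ ≠ ∞) (hc₁ : c₁ ≠ ∞)
    (h : ∀ s ∈ Ioc 0 L, ∀ t ∈ Ioc 0 L, s ≤ t →
      edist (F s) (F t) ≤ (G s + G t) * ENNReal.ofReal (t - s))
    (h₀ : ∀ s ∈ Ioc 0 L, edist F₀ (F s) ≤ (c₀ + G s) * ENNReal.ofReal s)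
    (h₁ : ∀ s ∈ Ioc 0 L, edist (F s) F₁ ≤ (G s + c₁) * ENNReal.ofReal (L - s)) :
    edist F₀ F₁ ≤ 6 * ∫⁻ s in Ioc 0 L, G s := by
  set T := ∫⁻ s in Ioc 0 L, G s with hT
  have key : ∀ n : ℕ, edist F₀ F₁ ≤ 6 * T + (c₀ + c₁) * ENNReal.ofReal (L / (n + 1)) := by
    intro n
    set l : ℝ := L / (n + 1) with hl
    have hl0 : 0 < l := by positivity
    have hnl : ((n : ℝ) + 1) * l = L := by rw [hl]; field_simp
    set A : ℕ → ℝ≥0∞ := fun i => ∫⁻ s in Ioc (i * l) ((i + 1) * l), G s with hA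
    have hvol : ∀ i : ℕ, volume (Ioc (i * l) ((i + 1) * l)) = ENNReal.ofReal l := by
      intro i; rw [Real.volume_Ioc]; congr 1; ring
    have hl0' : ENNReal.ofReal l ≠ 0 := (ENNReal.ofReal_pos.2 hl0).ne'
    -- Each of the `n + 1` pieces of length `l` contains a point where `G` is at most its average
    -- over the piece.
    have hpt : ∀ i : ℕ, ∃ s ∈ Ioc (i * l) ((i + 1) * l), G s * ENNReal.ofReal l ≤ A i := by
      intro i
      obtain ⟨s, hs, hs'⟩ := exists_le_setLAverage (μ := volume) (s := Ioc (i * l) ((i + 1) * l))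
        (f := G) (by rw [hvol]; exact hl0') (by rw [hvol]; exact ENNReal.ofReal_ne_top)
        hG.aemeasurable
      refine ⟨s, hs, ?_⟩
      rw [setLAverage_eq, hvol] at hs'
      exact (ENNReal.le_div_iff_mul_le (Or.inl hl0') (Or.inl ENNReal.ofReal_ne_top)).1 hs'
    choose s hs hsA using hpt
    have hsum : ∀ k : ℕ, ∑ i ∈ Finset.range k, A i = ∫⁻ s in Ioc 0 (k * l), G s := by
      intro k
      induction k with
      | zero => simp
      | succ k ih =>
        rw [Finset.sum_range_succ, ih, hA, ← lintegral_union measurableSet_Ioc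
          (Ioc_disjoint_Ioc_of_le le_rfl), Ioc_union_Ioc_eq_Ioc (by positivity)
          (by nlinarith)]
        push_cast; rfl
    have hTsum : ∑ i ∈ Finset.range (n + 1), A i = T := by
      rw [hsum, hT]; push_cast; rw [hnl]
    have hmem : ∀ i ≤ n, s i ∈ Ioc 0 L := by
      intro i hi
      refine ⟨lt_of_le_of_lt (by positivity) (hs i).1, (hs i).2.trans ?_⟩
      rw [← hnl]
      have : (i : ℝ) ≤ n := by exact_mod_cast hi
      nlinarith
    have hstep : ∀ i < n, edist (F (s i)) (F (s (i + 1))) ≤ 2 * (A i + A (i + 1)) := by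
      intro i hi
      have h1 := (hs i).1
      have h2 := (hs (i + 1)).2
      have h3 : s i ≤ s (i + 1) :=
        (hs i).2.trans (by have := (hs (i + 1)).1; push_cast at this; exact this.le)
      refine (h _ (hmem i hi.le) _ (hmem (i + 1) hi) h3).trans ?_
      -- Chosen points in adjacent pieces are at most `2 * l` apart.
      have h4 : ENNReal.ofReal (s (i + 1) - s i) ≤ 2 * ENNReal.ofReal l := by
        rw [← ENNReal.ofReal_ofNat, ← ENNReal.ofReal_mul zero_le_two]
        refine ENNReal.ofReal_le_ofReal ?_
        push_cast at h2
        linarith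
      calc (G (s i) + G (s (i + 1))) * ENNReal.ofReal (s (i + 1) - s i)
          ≤ (G (s i) + G (s (i + 1))) * (2 * ENNReal.ofReal l) := by gcongr
        _ = 2 * (G (s i) * ENNReal.ofReal l + G (s (i + 1)) * ENNReal.ofReal l) := by ring
        _ ≤ _ := by gcongr <;> apply hsA
    -- Every `A i` occurs in at most two steps of the chain, each time with factor 2. The two end
    -- steps add `T` each, which makes 6.
    have hmid : edist (F (s 0)) (F (s n)) ≤ 4 * T := by
      refine (edist_le_range_sum_edist (fun i => F (s i)) n).trans ?_
      calc ∑ i ∈ Finset.range n, edist (F (s i)) (F (s (i + 1)))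
          ≤ ∑ i ∈ Finset.range n, 2 * (A i + A (i + 1)) :=
            Finset.sum_le_sum fun i hi => hstep i (Finset.mem_range.1 hi)
        _ = 2 * (∑ i ∈ Finset.range n, A i + ∑ i ∈ Finset.range n, A (i + 1)) := by
            rw [← Finset.mul_sum, Finset.sum_add_distrib]
        _ ≤ 2 * (T + T) := by
            gcongr
            · rw [← hTsum, Finset.sum_range_succ]; exact le_self_add
            · rw [← hTsum, Finset.sum_range_succ']; exact le_self_add
        _ = 4 * T := by ring
    have hAT : ∀ i ≤ n, A i ≤ T := by
      intro i hi
      rw [← hTsum]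
      exact Finset.single_le_sum (fun _ _ => zero_le) (Finset.mem_range.2 (Nat.lt_succ_of_le hi))
    have hstart : edist F₀ (F (s 0)) ≤ c₀ * ENNReal.ofReal l + T := by
      refine (h₀ _ (hmem 0 n.zero_le)).trans ?_
      have h2 := (hs 0).2
      calc (c₀ + G (s 0)) * ENNReal.ofReal (s 0) ≤ (c₀ + G (s 0)) * ENNReal.ofReal l := by
            gcongr; simpa using h2
        _ = c₀ * ENNReal.ofReal l + G (s 0) * ENNReal.ofReal l := by ring
        _ ≤ _ := by gcongr; exact (hsA 0).trans (hAT 0 n.zero_le)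
    have hend : edist (F (s n)) F₁ ≤ T + c₁ * ENNReal.ofReal l := by
      refine (h₁ _ (hmem n le_rfl)).trans ?_
      have h2 := (hs n).1
      calc (G (s n) + c₁) * ENNReal.ofReal (L - s n) ≤ (G (s n) + c₁) * ENNReal.ofReal l := by
            gcongr; linarith
        _ = G (s n) * ENNReal.ofReal l + c₁ * ENNReal.ofReal l := by ring
        _ ≤ _ := by gcongr; exact (hsA n).trans (hAT n le_rfl)
    calc edist F₀ F₁ ≤ edist F₀ (F (s 0)) + edist (F (s 0)) (F (s n)) + edist (F (s n)) F₁ :=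
          edist_triangle4 _ _ _ _
      _ ≤ (c₀ * ENNReal.ofReal l + T) + 4 * T + (T + c₁ * ENNReal.ofReal l) := by gcongr
      _ = _ := by ring
  -- Refining the partition removes the end point contribution, because `c₀` and `c₁` are finite.
  have hlim : Tendsto (fun n : ℕ => 6 * T + (c₀ + c₁) * ENNReal.ofReal (L / (n + 1))) atTop
      (𝓝 (6 * T + (c₀ + c₁) * 0)) := by
    refine tendsto_const_nhds.add (ENNReal.Tendsto.const_mul ?_
      (Or.inr (ENNReal.add_ne_top.2 ⟨hc₀, hc₁⟩)))
    rw [← ENNReal.ofReal_zero]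
    refine ENNReal.tendsto_ofReal ?_
    simpa [div_eq_mul_inv] using (tendsto_one_div_add_atTop_nhds_zero_nat (𝕜 := ℝ)).const_mul L
  rw [mul_zero, add_zero] at hlim
  exact ge_of_tendsto' hlim key

/-- Linear interpolation between the values of a function at the two ends of a jump. -/
theorem edist_lineMap_le {X : Type*} [MetricSpace X] {f : X → ℝ} {g : X → ℝ≥0∞}
    (hfg : ∀ x y, edist (f x) (f y) ≤ (g x + g y) * edist x y) {p q : X} {a b : ℝ}
    (hpq : b - a = dist p q) {s t : ℝ} (hst : s ≤ t) :
    edist (AffineMap.lineMap (f p) (f q) ((s - a) / (b - a)))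
      (AffineMap.lineMap (f p) (f q) ((t - a) / (b - a)) : ℝ) ≤
        (g p + g q) * ENNReal.ofReal (t - s) := by
  -- If `a = b`, division by zero gives both interpolation parameters the value 0, so the left side
  -- vanishes.
  rcases (sub_nonneg.1 (hpq ▸ dist_nonneg) : a ≤ b).eq_or_lt with hab | hab
  · subst hab
    simp
  have hba : 0 < b - a := sub_pos.2 hab
  rw [edist_dist, dist_lineMap_lineMap, ENNReal.ofReal_mul dist_nonneg, ← edist_dist (f p),
    Real.dist_eq, ← sub_div, abs_div, abs_of_pos hba, abs_sub_comm, sub_sub_sub_cancel_right,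
    abs_of_nonneg (sub_nonneg.2 hst)]
  calc ENNReal.ofReal ((t - s) / (b - a)) * edist (f p) (f q)
      ≤ ENNReal.ofReal ((t - s) / (b - a)) * ((g p + g q) * ENNReal.ofReal (b - a)) := by
        gcongr
        rw [hpq, ← edist_dist]
        exact hfg p q
    _ = (g p + g q) * (ENNReal.ofReal ((t - s) / (b - a)) * ENNReal.ofReal (b - a)) := by ring
    _ = _ := by
        rw [← ENNReal.ofReal_mul (div_nonneg (sub_nonneg.2 hst) hba.le), div_mul_cancel₀ _ hba.ne']

/-! ### Parametrization of a test curve by its variation -/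

namespace TestCurve

variable {X : Type*} [MetricSpace X] (γ : TestCurve X)

/-- The generalized inverse of the variation function. -/
noncomputable def arrival (s : ℝ) : I :=
  -- Truncating `s` keeps the time 1 in the set, so the inverse is monotone on all of `ℝ`.
  sInf {t | min s (γ.variationFunction 1) ≤ γ.variationFunction t}

theorem arrival_le_iff {s : ℝ} {t : I} :
    γ.arrival s ≤ t ↔ min s (γ.variationFunction 1) ≤ γ.variationFunction t := by
  set S := {t | min s (γ.variationFunction 1) ≤ γ.variationFunction t} with hS
  have h1 : (1 : I) ∈ S := min_le_right s (γ.variationFunction 1)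
  have hbdd : BddBelow S := ⟨0, fun _ _ => unitInterval.nonneg'⟩
  refine ⟨fun h => ?_, fun h => csInf_le hbdd h⟩
  refine le_trans ?_ (γ.variationFunction.mono h)
  rcases eq_or_lt_of_le (unitInterval.le_one' : γ.arrival s ≤ 1) with h2 | h2
  · rw [h2]; exact min_le_right _ _
  have hb : (𝓝[>] γ.arrival s).NeBot := nhdsGT_neBot_of_exists_gt ⟨1, h2⟩
  refine ge_of_tendsto ((γ.variationFunction.right_continuous (γ.arrival s)).tendsto.mono_left
    (nhdsWithin_mono _ Ioi_subset_Ici_self)) ?_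
  filter_upwards [self_mem_nhdsWithin] with r hr
  obtain ⟨u, hu, hur⟩ := exists_lt_of_csInf_lt ⟨1, h1⟩ (show sInf S < r from hr)
  exact le_trans hu (γ.variationFunction.mono hur.le)

theorem monotone_arrival : Monotone γ.arrival := by
  intro s t hst
  rw [arrival_le_iff]
  exact (min_le_min_right _ hst).trans (γ.arrival_le_iff.1 le_rfl)

theorem le_variationFunction_arrival {s : ℝ} (hs : s ≤ γ.variationFunction 1) :
    s ≤ γ.variationFunction (γ.arrival s) := by
  have := γ.arrival_le_iff.1 (le_refl (γ.arrival s))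
  rwa [min_eq_left hs] at this

theorem leftLim_variationFunction_arrival_le {s : ℝ} (hs : s ∈ Ioc 0 (γ.variationFunction 1)) :
    leftLim γ.variationFunction (γ.arrival s) ≤ s := by
  rcases eq_or_lt_of_le (unitInterval.nonneg' : 0 ≤ γ.arrival s) with h | h
  · rw [← h, leftLim_eq_of_isBot fun _ => unitInterval.nonneg', variationFunction_zero]
    exact hs.1.le
  have hb : (𝓝[<] γ.arrival s).NeBot := nhdsLT_neBot_of_exists_lt ⟨0, h⟩
  refine le_of_tendsto (γ.tendsto_leftLim_variationFunction _) ?_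
  filter_upwards [self_mem_nhdsWithin] with t ht
  have : ¬ γ.arrival s ≤ t := not_le.2 ht
  rw [arrival_le_iff, min_eq_left hs.2] at this
  exact (not_le.1 this).le

/-- The parameters in `(0, V(γ)]` with arrival time at most `t` form exactly `(0, V_γ(t)]`, by the
Galois property `arrival_le_iff`. -/
theorem map_arrival : (volume.restrict (Ioc 0 (γ.variationFunction 1))).map γ.arrival =
    γ.variationFunction.measure := by
  refine (Measure.ext_of_Iic _ _ fun t => ?_).symm
  rw [measure_variationFunction_Iic, Measure.map_apply γ.monotone_arrival.measurable
    measurableSet_Iic, Measure.restrict_apply (γ.monotone_arrival.measurable measurableSet_Iic)]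
  have : γ.arrival ⁻¹' Iic t ∩ Ioc 0 (γ.variationFunction 1) = Ioc 0 (γ.variationFunction t) := by
    ext s
    simp only [mem_inter_iff, mem_preimage, mem_Iic, mem_Ioc, arrival_le_iff]
    constructor
    · rintro ⟨h1, h2, h3⟩
      exact ⟨h2, by rwa [min_eq_left h3] at h1⟩
    · rintro ⟨h1, h2⟩
      have h3 := h2.trans (γ.variationFunction.mono (unitInterval.le_one' : t ≤ 1))
      exact ⟨by rwa [min_eq_left h3], h1, h3⟩
  rw [this, Real.volume_Ioc, sub_zero]

/-- The increment of a function along a test curve is controlled by the symmetrized integral of a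
pointwise Hajłasz gradient that is finite at the end points of the curve. -/
theorem edist_le_symmIntegral {f : X → ℝ} {g : X → ℝ≥0∞} (hg : Measurable[borel X] g)
    (hfg : ∀ x y, edist (f x) (f y) ≤ (g x + g y) * edist x y)
    (h0 : g (γ 0) ≠ ∞) (h1 : g (γ 1) ≠ ∞) :
    edist (f (γ 0)) (f (γ 1)) ≤ 12 * γ.symmIntegral g := by
  rcases (γ.variationFunction_nonneg 1).eq_or_lt with hL | hL
  · have := γ.dist_le_variationFunction_sub (unitInterval.nonneg' : (0 : I) ≤ 1)
    rw [← hL, variationFunction_zero, sub_zero] at this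
    rw [dist_le_zero.1 this, edist_self]
    exact zero_le
  set V := γ.variationFunction
  -- For `s` in `(0, V 1]`, `[a s, b s]` is the parameter interval of the jump from `p s` to `q s`
  -- at the arrival time of `s`. It reduces to a point if there is no jump.
  set a : ℝ → ℝ := fun s => leftLim V (γ.arrival s)
  set b : ℝ → ℝ := fun s => V (γ.arrival s)
  set p : ℝ → X := fun s => leftLim γ (γ.arrival s)
  set q : ℝ → X := fun s => γ (γ.arrival s)
  set G : ℝ → ℝ≥0∞ := fun s => g (p s) + g (q s)
  set F : ℝ → ℝ := fun s => AffineMap.lineMap (f (p s)) (f (q s)) ((s - a s) / (b s - a s))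
  have hpq : ∀ s, b s - a s = dist (p s) (q s) := fun s => γ.variationFunction_sub_leftLim _
  have ha : ∀ s ∈ Ioc 0 (V 1), a s ≤ s := fun s hs => γ.leftLim_variationFunction_arrival_le hs
  have hb : ∀ s ∈ Ioc 0 (V 1), s ≤ b s := fun s hs => γ.le_variationFunction_arrival hs.2
  have hFa : ∀ s, (AffineMap.lineMap (f (p s)) (f (q s)) ((a s - a s) / (b s - a s)) : ℝ) =
      f (p s) := by intro s; simp
  have hFb : ∀ s, (AffineMap.lineMap (f (p s)) (f (q s)) ((b s - a s) / (b s - a s)) : ℝ) =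
      f (q s) := by
    intro s
    rcases eq_or_ne (b s - a s) 0 with h | h
    · have : p s = q s := by rw [← dist_eq_zero, ← hpq, h]
      simp [this]
    · rw [div_self h, AffineMap.lineMap_apply_one]
  have hleft : ∀ s ∈ Ioc 0 (V 1), edist (f (p s)) (F s) ≤ G s * ENNReal.ofReal (s - a s) := by
    intro s hs
    have := edist_lineMap_le hfg (hpq s) (ha s hs)
    rwa [hFa] at this
  have hright : ∀ s ∈ Ioc 0 (V 1), edist (F s) (f (q s)) ≤ G s * ENNReal.ofReal (b s - s) := by
    intro s hs
    have := edist_lineMap_le hfg (hpq s) (hb s hs)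
    rwa [hFb] at this
  have hG : Measurable G :=
    ((γ.measurable_comp_leftLim hg).add (γ.measurable_comp hg)).comp γ.monotone_arrival.measurable
  have hint : ∫⁻ s in Ioc 0 (V 1), G s = 2 * γ.symmIntegral g := by
    rw [two_mul_symmIntegral γ hg, ← γ.map_arrival]
    exact (lintegral_map ((γ.measurable_comp_leftLim hg).add (γ.measurable_comp hg))
      γ.monotone_arrival.measurable).symm
  have hgle : ∀ s, g (q s) ≤ G s := fun s => le_add_self
  have hgle' : ∀ s, g (p s) ≤ G s := fun s => le_self_add
  have main := edist_le_six_mul_lintegral (F := F) hL hG h0 h1 (F₀ := f (γ 0)) (F₁ := f (γ 1))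
    ?_ ?_ ?_
  · rw [hint, ← mul_assoc] at main
    norm_num at main
    exact main
  · intro s hs t ht hst
    -- Equal arrival times mean one common jump, where `F` is affine. Otherwise pass through `f (q
    -- s)` and `f (p t)`: the lengths `b s - s`, `a t - b s` and `t - a t` add up to `t - s`.
    rcases (γ.monotone_arrival hst).eq_or_lt with heq | hlt
    · have h2 := edist_lineMap_le hfg (hpq s) hst
      have h3 : (AffineMap.lineMap (f (p s)) (f (q s)) ((t - a s) / (b s - a s)) : ℝ) = F t := by
        simp only [F, p, q, a, b, heq]
      rw [h3] at h2
      exact h2.trans (mul_le_mul' (le_self_add (a := G s)) le_rfl)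
    · have hd : dist (q s) (p t) ≤ a t - b s := γ.dist_leftLim_le hlt
      have hd0 : 0 ≤ a t - b s := dist_nonneg.trans hd
      have h2 : edist (f (q s)) (f (p t)) ≤ (G s + G t) * ENNReal.ofReal (a t - b s) := by
        refine (hfg _ _).trans ?_
        rw [edist_dist]
        gcongr
        · exact hgle s
        · exact hgle' t
      calc edist (F s) (F t)
          ≤ edist (F s) (f (q s)) + edist (f (q s)) (f (p t)) + edist (f (p t)) (F t) :=
            edist_triangle4 _ _ _ _
        _ ≤ (G s + G t) * ENNReal.ofReal (b s - s) + (G s + G t) * ENNReal.ofReal (a t - b s) +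
              (G s + G t) * ENNReal.ofReal (t - a t) := by
            gcongr
            · refine (hright s hs).trans ?_
              gcongr
              exact le_self_add
            · refine (hleft t ht).trans ?_
              gcongr
              exact le_add_self
        _ = (G s + G t) * ENNReal.ofReal (t - s) := by
            rw [← mul_add, ← mul_add, ← ENNReal.ofReal_add (sub_nonneg.2 (hb s hs)) hd0,
              ← ENNReal.ofReal_add (add_nonneg (sub_nonneg.2 (hb s hs)) hd0)
                (sub_nonneg.2 (ha t ht))]
            congr 2
            ring
  · intro s hs
    -- Since `V 0 = 0 < s`, the arrival time is positive, so `γ 0` strictly precedes the left limit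
    -- `p s`.
    have hpos : 0 < γ.arrival s := by
      refine lt_of_not_ge fun h => ?_
      rw [arrival_le_iff, variationFunction_zero, min_eq_left hs.2] at h
      exact absurd hs.1 (not_lt.2 h)
    have hd : dist (γ 0) (p s) ≤ a s := by
      simpa [variationFunction_zero] using γ.dist_leftLim_le hpos
    have h2 : edist (f (γ 0)) (f (p s)) ≤ (g (γ 0) + G s) * ENNReal.ofReal (a s) := by
      refine (hfg _ _).trans ?_
      rw [edist_dist]
      gcongr
      exact hgle' s
    calc edist (f (γ 0)) (F s) ≤ edist (f (γ 0)) (f (p s)) + edist (f (p s)) (F s) :=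
          edist_triangle _ _ _
      _ ≤ (g (γ 0) + G s) * ENNReal.ofReal (a s) + (g (γ 0) + G s) * ENNReal.ofReal (s - a s) := by
          gcongr
          refine (hleft s hs).trans ?_
          gcongr
          exact le_add_self
      _ = (g (γ 0) + G s) * ENNReal.ofReal s := by
          rw [← mul_add, ← ENNReal.ofReal_add (dist_nonneg.trans hd) (sub_nonneg.2 (ha s hs))]
          congr 2
          ring
  · intro s hs
    have hd : dist (q s) (γ 1) ≤ V 1 - b s :=
      γ.dist_le_variationFunction_sub unitInterval.le_one'
    have h2 : edist (f (q s)) (f (γ 1)) ≤ (G s + g (γ 1)) * ENNReal.ofReal (V 1 - b s) := by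
      refine (hfg _ _).trans ?_
      rw [edist_dist]
      gcongr
      exact hgle s
    calc edist (F s) (f (γ 1)) ≤ edist (F s) (f (q s)) + edist (f (q s)) (f (γ 1)) :=
          edist_triangle _ _ _
      _ ≤ (G s + g (γ 1)) * ENNReal.ofReal (b s - s) +
            (G s + g (γ 1)) * ENNReal.ofReal (V 1 - b s) := by
          gcongr
          refine (hright s hs).trans ?_
          gcongr
          exact le_self_add
      _ = (G s + g (γ 1)) * ENNReal.ofReal (V 1 - s) := by
          rw [← mul_add, ← ENNReal.ofReal_add (sub_nonneg.2 (hb s hs)) (dist_nonneg.trans hd)]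
          congr 2
          ring

end TestCurve

/-! ### Borel representatives and part (a) -/

theorem IsBorelRegular.exists_borel_null_superset {X : Type*} [TopologicalSpace X]
    [MeasurableSpace X] {μ : Measure X} (hμ : IsBorelRegular μ) {N : Set X}
    (hN : μ N = 0) : ∃ B, MeasurableSet[borel X] B ∧ N ⊆ B ∧ μ B = 0 := by
  obtain ⟨B, hB, hNB, hBN⟩ := hμ _ (measurableSet_toMeasurable μ N)
  exact ⟨B, hB, (subset_toMeasurable μ N).trans hNB, by rw [hBN, measure_toMeasurable, hN]⟩

section BorelRegular

variable {X : Type*} [MetricSpace X] [MeasurableSpace X] [OpensMeasurableSpace X] {μ : Measure X}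

/-- Take Borel hulls of the pieces of `A` of finite measure. Finiteness makes each hull exceed its
piece by a null set, and Borel regularity puts that null set inside a Borel null set. So `A` is a
Borel set minus a null set. -/
theorem IsBorelRegular.nullMeasurableSet_trim [SigmaFinite μ] (hμ : IsBorelRegular μ) {A : Set X}
    (hA : MeasurableSet A) :
    @NullMeasurableSet X (borel X) A (μ.trim OpensMeasurableSpace.borel_le) := by
  have hle : borel X ≤ ‹MeasurableSpace X› := OpensMeasurableSpace.borel_le
  have hzero : ∀ N : Set X, MeasurableSet N → μ N = 0 →
      μ.trim OpensMeasurableSpace.borel_le N = 0 := by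
    intro N hN h0
    obtain ⟨B, hB, hNB, hBN⟩ := hμ N hN
    refine measure_mono_null hNB ?_
    rw [trim_measurableSet_eq _ hB, hBN, h0]
  choose B hB hAB hBA using fun n : ℕ =>
    hμ (A ∩ spanningSets μ n) (hA.inter (measurableSet_spanningSets μ n))
  have hdiff : μ.trim OpensMeasurableSpace.borel_le ((⋃ n, B n) \ A) = 0 := by
    refine measure_mono_null (t := ⋃ n, (B n \ (A ∩ spanningSets μ n))) ?_ ?_
    · rintro x ⟨hx, hxA⟩
      obtain ⟨n, hn⟩ := mem_iUnion.1 hx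
      exact mem_iUnion.2 ⟨n, hn, fun h => hxA h.1⟩
    · refine measure_iUnion_null fun n => hzero _
        ((hle _ (hB n)).diff (hA.inter (measurableSet_spanningSets μ n))) ?_
      rw [measure_sdiff (hAB n) (hA.inter (measurableSet_spanningSets μ n)).nullMeasurableSet
        ((measure_mono inter_subset_right).trans_lt (measure_spanningSets_lt_top μ n)).ne, hBA,
        tsub_self]
  have hsub : A ⊆ ⋃ n, B n := by
    intro x hx
    have : x ∈ ⋃ n, spanningSets μ n := by rw [iUnion_spanningSets]; trivial
    obtain ⟨n, hn⟩ := mem_iUnion.1 this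
    exact mem_iUnion.2 ⟨n, hAB n ⟨hx, hn⟩⟩
  have hnull : @NullMeasurableSet X (borel X) ((⋃ n, B n) \ A)
      (μ.trim OpensMeasurableSpace.borel_le) :=
    @NullMeasurableSet.of_null X (borel X) _ _ hdiff
  have := @NullMeasurableSet.diff X (borel X) _ _ _
    (@MeasurableSet.nullMeasurableSet X (borel X) _ _ (@MeasurableSet.iUnion X ℕ (borel X) _ _ hB))
    hnull
  rwa [sdiff_sdiff_cancel_left hsub] at this

theorem IsBorelRegular.exists_borel_ae_eq [SigmaFinite μ] (hμ : IsBorelRegular μ) {β : Type*}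
    [MeasurableSpace β] [MeasurableSpace.CountablyGenerated β] {f : X → β}
    (hf : Measurable f) : ∃ f' : X → β, Measurable[borel X] f' ∧ f =ᵐ[μ] f' := by
  have h : @AEMeasurable X β _ (borel X) f (μ.trim OpensMeasurableSpace.borel_le) :=
    have : @NullMeasurable X β (borel X) _ f (μ.trim OpensMeasurableSpace.borel_le) :=
      fun s hs => hμ.nullMeasurableSet_trim (hf hs)
    this.aemeasurable
  obtain ⟨f', hf', hff'⟩ := h
  exact ⟨f', hf', ae_of_ae_trim _ hff'⟩

/-- A Hajłasz gradient has Borel representatives for which the Hajłasz inequality holds at all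
points. -/
theorem IsHajlaszGradient.exists_borel [SigmaFinite μ] (hμ : IsBorelRegular μ) {f : X → EReal}
    {g : X → ℝ≥0∞} (hg_fin : ∀ᵐ x ∂μ, g x ≠ ∞) (h : IsHajlaszGradient μ f g) :
    ∃ (f' : X → ℝ) (g' : X → ℝ≥0∞), Measurable[borel X] f' ∧ Measurable[borel X] g' ∧
      (∀ᵐ x ∂μ, f x = (f' x : EReal)) ∧ (∀ᵐ x ∂μ, g x = g' x) ∧
      (∃ B, MeasurableSet[borel X] B ∧ μ B = 0 ∧ ∀ x ∉ B, g' x ≠ ∞) ∧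
      ∀ x y, edist (f' x) (f' y) ≤ (g' x + g' y) * edist x y := by
  classical
  obtain ⟨hf, hf_fin, hg, E, -, hE0, hE⟩ := h
  obtain ⟨f₁, hf₁, hff₁⟩ := hμ.exists_borel_ae_eq hf
  obtain ⟨g₁, hg₁, hgg₁⟩ := hμ.exists_borel_ae_eq hg
  have hall : ∀ᵐ x ∂μ, f x = f₁ x ∧ g x = g₁ x ∧ (f x ≠ ⊤ ∧ f x ≠ ⊥) ∧ g x ≠ ∞ ∧ x ∉ E := by
    filter_upwards [hff₁, hgg₁, hf_fin, hg_fin, measure_eq_zero_iff_ae_notMem.1 hE0]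
      with x h1 h2 h3 h4 h5 using ⟨h1, h2, h3, h4, h5⟩
  -- On `B` the new gradient is `∞`, so the inequality is trivial there for distinct points. The
  -- diagonal is separate, since `∞ * 0 = 0`.
  obtain ⟨B, hB, hNB, hB0⟩ := hμ.exists_borel_null_superset (ae_iff.1 hall)
  have hout : ∀ x ∉ B, f x = f₁ x ∧ g x = g₁ x ∧ (f x ≠ ⊤ ∧ f x ≠ ⊥) ∧ g x ≠ ∞ ∧ x ∉ E :=
    fun x hx => by_contra fun h => hx (hNB h)
  have haeB : ∀ᵐ x ∂μ, x ∉ B := measure_eq_zero_iff_ae_notMem.1 hB0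
  have hcoe : ∀ x ∉ B, f x = ((f₁ x).toReal : EReal) := fun x hx => by
    obtain ⟨h1, -, h3, -⟩ := hout x hx
    rw [← h1, EReal.coe_toReal h3.1 h3.2]
  have hnotin : ∀ x ∉ B, (fun x => if x ∈ B then ∞ else g₁ x) x = g x := fun x hx => by
    rw [(hout x hx).2.1]; exact if_neg hx
  refine ⟨fun x => (f₁ x).toReal, fun x => if x ∈ B then ∞ else g₁ x,
    measurable_ereal_toReal.comp hf₁,
    Measurable.ite (p := (· ∈ B)) hB measurable_const hg₁,
    haeB.mono hcoe, haeB.mono fun x hx => (hnotin x hx).symm,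
    ⟨B, hB, hB0, fun x hx => by rw [hnotin x hx]; exact (hout x hx).2.2.2.1⟩, fun x y => ?_⟩
  rcases eq_or_ne x y with rfl | hxy
  · simp
  have hd : edist x y ≠ 0 := by simpa [edist_eq_zero] using hxy
  by_cases hx : x ∈ B
  · simp [hx, ENNReal.top_mul hd]
  by_cases hy : y ∈ B
  · simp [hy, ENNReal.top_mul hd]
  have := hE x (hout x hx).2.2.2.2 y (hout y hy).2.2.2.2
  rw [hcoe x hx, hcoe y hy, absDiff_coe, ← hnotin x hx, ← hnotin y hy, ← Real.dist_eq,
    ← edist_dist, edist_comm] at this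
  exact this

end BorelRegular

namespace TestCurve

variable {X : Type*} [MetricSpace X]

theorem symmIntegral_const_mul (γ : TestCurve X) {c : ℝ≥0∞} (hc : c ≠ ∞) (g : X → ℝ≥0∞) :
    γ.symmIntegral (fun x => c * g x) = c * γ.symmIntegral g := by
  simp only [symmIntegral, integral]
  rw [lintegral_const_mul' _ _ hc, lintegral_const_mul' _ _ hc, ← mul_add, mul_div_assoc]

theorem symmIntegral_mono (γ : TestCurve X) {g h : X → ℝ≥0∞} (hgh : g ≤ h) :
    γ.symmIntegral g ≤ γ.symmIntegral h := by
  simp only [symmIntegral, integral]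
  gcongr <;> apply hgh

end TestCurve

/-- A pointwise Hajłasz gradient is, up to a constant, an upper S-gradient. -/
theorem isMeasureUpperSGradient_of_edist_le {X : Type*} [MetricSpace X] [MeasurableSpace X]
    {μ : Measure X} {f : X → ℝ} {g : X → ℝ≥0∞} (hf : Measurable[borel X] f)
    (hg : Measurable[borel X] g) {B : Set X} (hB : MeasurableSet[borel X] B) (hB0 : μ B = 0)
    (hgB : ∀ x ∉ B, g x ≠ ∞)
    (hfg : ∀ x y, edist (f x) (f y) ≤ (g x + g y) * edist x y) {c : ℝ≥0∞} (hc : 12 ≤ c) :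
    IsMeasureUpperSGradient μ (fun x => (f x : EReal)) (fun x => c * g x) := by
  refine ⟨measurable_coe_real_ereal.comp hf,
    (measurable_const_mul c).comp hg, fun P hP _ => ?_⟩
  obtain ⟨-, ⟨C, hC⟩, -⟩ := hP
  -- The marginal bound gives `P {γ | γ t ∈ B} ≤ C * μ B = 0`. It is needed only at times 0 and 1.
  have hae : ∀ t : I, ∀ᵐ γ ∂P, g (TestCurve.toFun γ t) ≠ ∞ := by
    intro t
    have h0 : P {γ | γ t ∈ B} = 0 := le_antisymm ((hC t B hB).trans (by simp [hB0])) zero_le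
    filter_upwards [measure_eq_zero_iff_ae_notMem.1 h0] with γ hγ using hgB _ hγ
  refine lintegral_mono_ae ?_
  filter_upwards [hae 0, hae 1] with γ h0 h1
  calc absDiff (f (γ 1)) (f (γ 0)) = edist (f (γ 0)) (f (γ 1)) := by
        rw [absDiff_coe, ← Real.dist_eq, ← edist_dist, edist_comm]
    _ ≤ 12 * γ.symmIntegral g := γ.edist_le_symmIntegral hg hfg h0 h1
    _ = γ.symmIntegral fun x => 12 * g x :=
        (γ.symmIntegral_const_mul ENNReal.ofNat_ne_top g).symm
    _ ≤ _ := γ.symmIntegral_mono fun x => by dsimp only; gcongr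

/-! ### Measurability of evaluation and curves with one jump -/

namespace TestCurve

variable {X : Type*} [MetricSpace X]

section Evaluation

theorem abs_min_infDist_sub_le (F : Set X) (x y : X) :
    |min 1 (Metric.infDist x F) - min 1 (Metric.infDist y F)| ≤ min 1 (dist x y) := by
  have hx : 0 ≤ Metric.infDist x F := Metric.infDist_nonneg
  have hy : 0 ≤ Metric.infDist y F := Metric.infDist_nonneg
  have h1 : Metric.infDist x F ≤ Metric.infDist y F + dist x y := Metric.infDist_le_infDist_add_dist
  have h2 : Metric.infDist y F ≤ Metric.infDist x F + dist x y := by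
    rw [dist_comm]; exact Metric.infDist_le_infDist_add_dist
  rw [abs_le]
  constructor <;> simp only [min_def] <;> split_ifs <;> linarith

theorem integrable_min_infDist (γ : TestCurve X) (F : Set X) :
    Integrable fun s : I => min 1 (Metric.infDist (γ s) F) := by
  refine Integrable.of_bound (C := 1)
    (measurable_const.min (measurable_infDist_comp γ.boundedVariation F)).aestronglyMeasurable
    (ae_of_all _ fun t => ?_)
  rw [Real.norm_of_nonneg (le_min zero_le_one Metric.infDist_nonneg)]
  exact min_le_left _ _

/-- The truncated distance to `F` changes by at most the truncated distance between the points, so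
the integral is 1-Lipschitz for the metric on test curves. -/
theorem continuous_setIntegral_min_infDist (F : Set X) (J : Set I) :
    Continuous fun γ : TestCurve X => ∫ s in J, min 1 (Metric.infDist (γ s) F) := by
  refine (LipschitzWith.of_dist_le_mul (K := 1) fun γ γ' => ?_).continuous
  rw [Real.dist_eq, ← integral_sub (γ.integrable_min_infDist F).integrableOn
    (γ'.integrable_min_infDist F).integrableOn, NNReal.coe_one, one_mul]
  refine (abs_integral_le_integral_abs).trans ?_
  refine (integral_mono ((γ.integrable_min_infDist F).sub
    (γ'.integrable_min_infDist F)).abs.integrableOn (integrable_min_dist γ γ').integrableOn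
    fun s => abs_min_infDist_sub_le F _ _).trans ?_
  exact setIntegral_le_integral (integrable_min_dist γ γ')
    (ae_of_all _ fun s => le_min zero_le_one dist_nonneg)

/-- Evaluation at one time is not continuous for an integral metric, but here it is a limit of
averages over sets of positive measure shrinking along `l`. The filter stands for the side from
which all test curves converge to `γ t`: the right if `t < 1`, the left if `t = 1`. -/
theorem measurable_min_infDist_eval {t : I} {l : Filter I} [l.IsCountablyGenerated]
    (hl : ∀ γ : TestCurve X, Tendsto γ l (𝓝 (γ t)))
    (hvol : ∀ U ∈ l, ∃ J ⊆ U, MeasurableSet J ∧ volume J ≠ 0) (F : Set X) :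
    Measurable fun γ : TestCurve X => min 1 (Metric.infDist (γ t) F) := by
  obtain ⟨U, hU⟩ := l.exists_antitone_basis
  choose J hJU hJm hJ using fun n => hvol (U n) (hU.mem n)
  refine measurable_of_tendsto_metrizable (f := fun n γ =>
    ⨍ s in J n, min 1 (Metric.infDist (TestCurve.toFun γ s) F)) (fun n => ?_) ?_
  · simp only [setAverage_eq, smul_eq_mul]
    exact ((continuous_setIntegral_min_infDist F (J n)).measurable).const_mul _
  · rw [tendsto_pi_nhds]
    intro γ
    have hcont : Continuous fun x : X => min 1 (Metric.infDist x F) :=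
      continuous_const.min (Metric.continuous_infDist_pt F)
    have hlim := (hcont.tendsto (γ t)).comp (hl γ)
    refine Metric.nhds_basis_closedBall.tendsto_right_iff.2 fun ε hε => ?_
    have hev := hlim.eventually (Metric.closedBall_mem_nhds _ hε)
    obtain ⟨n, -, hn⟩ := hU.1.mem_iff.1 hev
    filter_upwards [eventually_ge_atTop n] with k hk
    refine (convex_closedBall _ ε).set_average_mem Metric.isClosed_closedBall (hJ k)
      (measure_ne_top _ _) ?_ (γ.integrable_min_infDist F).integrableOn
    exact (ae_restrict_iff' (hJm k)).2 (ae_of_all _ fun s hs => hn (hU.2 hk (hJU k hs)))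

theorem volume_Ioo_ne_zero {u v : I} (huv : u < v) : volume (Ioo u v) ≠ 0 := by
  rw [unitInterval.volume_Ioo]
  exact (ENNReal.ofReal_pos.2 (sub_pos.2 huv)).ne'

/-- Evaluation of test curves at a given time is Borel measurable. -/
theorem measurable_eval [MeasurableSpace X] [BorelSpace X] (t : I) :
    Measurable fun γ : TestCurve X => γ t := by
  refine measurable_of_isClosed fun F hF => ?_
  rcases F.eq_empty_or_nonempty with rfl | hne
  · simp
  have hmeas : Measurable fun γ : TestCurve X => min 1 (Metric.infDist (γ t) F) := by
    rcases eq_or_lt_of_le (unitInterval.le_one' : t ≤ 1) with rfl | h1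
    · refine measurable_min_infDist_eval (l := 𝓝[<] 1) (fun γ => γ.leftContinuous_one.tendsto.mono_left
        (nhdsWithin_mono _ Iio_subset_Iic_self)) (fun U hU => ?_) F
      obtain ⟨u, hu, hU⟩ := (mem_nhdsLT_iff_exists_Ioo_subset' (zero_lt_one (α := I))).1 hU
      exact ⟨_, hU, measurableSet_Ioo, volume_Ioo_ne_zero hu⟩
    · refine measurable_min_infDist_eval (l := 𝓝[>] t) (fun γ => (γ.rightContinuous t).tendsto.mono_left
        (nhdsWithin_mono _ Ioi_subset_Ici_self)) (fun U hU => ?_) F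
      obtain ⟨u, hu, hU⟩ := (mem_nhdsGT_iff_exists_Ioo_subset' h1).1 hU
      exact ⟨_, hU, measurableSet_Ioo, volume_Ioo_ne_zero hu⟩
  have : (fun γ : TestCurve X => γ t) ⁻¹' F =
      (fun γ : TestCurve X => min 1 (Metric.infDist (γ t) F)) ⁻¹' {0} := by
    ext γ
    simp only [mem_preimage, mem_singleton_iff, hF.mem_iff_infDist_zero hne]
    constructor
    · intro h; rw [h]; simp
    · intro h
      by_contra h0
      exact (lt_min one_pos (lt_of_le_of_ne Metric.infDist_nonneg (Ne.symm h0))).ne' h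
  rw [this]
  exact hmeas (measurableSet_singleton 0)

end Evaluation

section Jump

/-- The midpoint of the unit interval. -/
noncomputable def half : I := ⟨1 / 2, by norm_num, by norm_num⟩

theorem half_pos : 0 < half := Subtype.mk_lt_mk.2 (by norm_num)

theorem half_lt_one : half < 1 := Subtype.mk_lt_mk.2 (by norm_num)

open Classical in
/-- The step function that jumps from `u` to `v` at time `1/2`. -/
noncomputable def step {Y : Type*} (u v : Y) (t : I) : Y := if t < half then u else v

theorem step_of_lt {Y : Type*} (u v : Y) {t : I} (h : t < half) : step u v t = u := if_pos h

theorem step_of_le {Y : Type*} (u v : Y) {t : I} (h : half ≤ t) : step u v t = v := if_neg (not_lt.2 h)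

theorem tendsto_step_left (u v : X) {t : I} (h : t ≤ half) :
    Tendsto (step u v) (𝓝[<] t) (𝓝 u) := by
  refine tendsto_const_nhds.congr' ?_
  filter_upwards [self_mem_nhdsWithin] with s hs using (step_of_lt u v (lt_of_lt_of_le hs h)).symm

theorem tendsto_step_of_lt (u v : X) {t : I} (h : half < t) : Tendsto (step u v) (𝓝 t) (𝓝 v) := by
  refine tendsto_const_nhds.congr' ?_
  filter_upwards [Ioi_mem_nhds h] with s hs using (step_of_le u v (le_of_lt hs)).symm

theorem eVariationOn_step (u v : X) : eVariationOn (step u v) univ = edist u v := by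
  have hb : (𝓝[<] half).NeBot := nhdsLT_neBot_of_exists_lt ⟨0, half_pos⟩
  have h1 : eVariationOn (step u v) (Iic half) = edist v u := by
    have h := eVariationOn.eVariationOn_on_inter_Iic_eq_Iio_add_edist (f := step u v) (s := univ)
      (a := half) (l := u) (by simpa using hb) (mem_univ _)
      (by simpa using tendsto_step_left u v le_rfl)
    have h0 : eVariationOn (step u v) (Iio half) = 0 := by
      apply eVariationOn.constant_on
      rintro _ ⟨s, hs, rfl⟩ _ ⟨r, hr, rfl⟩
      rw [step_of_lt u v hs, step_of_lt u v hr]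
    rwa [univ_inter, univ_inter, step_of_le u v le_rfl, h0, zero_add] at h
  rw [← Iic_union_Ici (a := half), eVariationOn.union _ isGreatest_Iic isLeast_Ici, h1,
    eVariationOn.constant_on, add_zero, edist_comm]
  rintro _ ⟨s, hs, rfl⟩ _ ⟨r, hr, rfl⟩
  rw [step_of_le u v hs, step_of_le u v hr]

/-- The test curve that jumps from `u` to `v` at time `1/2`. -/
noncomputable def jump (u v : X) : TestCurve X where
  toFun := step u v
  boundedVariation := by
    rw [BoundedVariationOn, eVariationOn_step]
    exact edist_ne_top _ _
  rightContinuous t := by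
    rcases lt_or_ge t half with h | h
    · refine ContinuousAt.continuousWithinAt ?_
      rw [ContinuousAt, step_of_lt u v h]
      refine tendsto_const_nhds.congr' ?_
      filter_upwards [Iio_mem_nhds h] with s hs using (step_of_lt u v hs).symm
    · rw [ContinuousWithinAt, step_of_le u v h]
      refine tendsto_const_nhds.congr' ?_
      filter_upwards [self_mem_nhdsWithin] with s hs using (step_of_le u v (h.trans hs)).symm
  leftContinuous_one := by
    rw [ContinuousWithinAt, step_of_le u v half_lt_one.le]
    exact (tendsto_step_of_lt u v half_lt_one).mono_left nhdsWithin_le_nhds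
  exists_leftLimit t _ _ := by
    rcases le_or_gt t half with h | h
    · exact ⟨u, tendsto_step_left u v h⟩
    · exact ⟨v, (tendsto_step_of_lt u v h).mono_left nhdsWithin_le_nhds⟩

theorem jump_of_lt (u v : X) {t : I} (h : t < half) : jump u v t = u := step_of_lt u v h

theorem jump_of_le (u v : X) {t : I} (h : half ≤ t) : jump u v t = v := step_of_le u v h

theorem variation_jump (u v : X) : (jump u v).variation = edist u v := eVariationOn_step u v

theorem leftLim_jump_half (u v : X) : leftLim (jump u v) half = u :=
  haveI : (𝓝[<] half).NeBot := nhdsLT_neBot_of_exists_lt ⟨0, half_pos⟩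
  leftLim_eq_of_tendsto (tendsto_step_left u v le_rfl)

theorem measure_jump_singleton (u v : X) :
    (jump u v).variationFunction.measure {half} = edist u v := by
  rw [StieltjesFunction.measure_singleton, variationFunction_sub_leftLim, leftLim_jump_half,
    jump_of_le u v le_rfl, edist_dist]

theorem measure_jump_compl (u v : X) :
    (jump u v).variationFunction.measure {half}ᶜ = 0 := by
  rw [measure_compl (measurableSet_singleton _) (measure_ne_top _ _), measure_jump_singleton,
    show (univ : Set I) = Iic 1 from (eq_univ_of_forall fun _ => unitInterval.le_one').symm,
    measure_variationFunction_Iic, variationFunction_one, variation_jump,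
    ENNReal.ofReal_toReal (edist_ne_top _ _), tsub_self]

/-- The variation measure of a jump curve is one atom at time 1/2, of mass `d(u, v)`. -/
theorem lintegral_jump (u v : X) (h : I → ℝ≥0∞) :
    ∫⁻ t, h t ∂(jump u v).variationFunction.measure = h half * edist u v := by
  rw [← lintegral_add_compl h (measurableSet_singleton half), lintegral_singleton,
    measure_jump_singleton, Measure.restrict_eq_zero.2 (measure_jump_compl u v),
    lintegral_zero_measure, add_zero]

theorem symmIntegral_jump (u v : X) {g : X → ℝ≥0∞} (hg : Measurable[borel X] g) :
    (jump u v).symmIntegral g = (g u + g v) / 2 * edist u v := by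
  have h := two_mul_symmIntegral (jump u v) hg
  rw [lintegral_jump, leftLim_jump_half, jump_of_le u v le_rfl] at h
  rw [ENNReal.mul_div_right_comm.symm, ← h, mul_comm, ENNReal.mul_div_cancel_right two_ne_zero
    ENNReal.ofNat_ne_top]

theorem dist_jump_le (u v u' v' : X) :
    dist (jump u v) (jump u' v') ≤ dist u u' + dist v v' := by
  calc dist (jump u v) (jump u' v')
      = ∫ t : I, min 1 (dist (jump u v t) (jump u' v' t)) := rfl
    _ ≤ ∫ _ : I, (dist u u' + dist v v') := by
        refine integral_mono (integrable_min_dist _ _) (integrable_const _) fun t => ?_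
        refine (min_le_right _ _).trans ?_
        rcases lt_or_ge t half with h | h
        · rw [jump_of_lt u v h, jump_of_lt u' v' h]
          exact le_add_of_nonneg_right dist_nonneg
        · rw [jump_of_le u v h, jump_of_le u' v' h]
          exact le_add_of_nonneg_left dist_nonneg
    _ = dist u u' + dist v v' := by simp

theorem continuous_jump : Continuous fun p : X × X => jump p.1 p.2 := by
  refine (LipschitzWith.of_dist_le_mul (K := 2) fun p q => ?_).continuous
  refine (dist_jump_le _ _ _ _).trans ?_
  rw [Prod.dist_eq, NNReal.coe_ofNat, two_mul]
  exact add_le_add (le_max_left _ _) (le_max_right _ _)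

end Jump

end TestCurve

/-! ### Random jumps between two sets -/

theorem enorm_toReal_sub_le_absDiff (a b : EReal) : ‖a.toReal - b.toReal‖ₑ ≤ absDiff a b := by
  induction a <;> induction b <;> simp [absDiff]
  rw [← EReal.coe_sub, EReal.abs_def, Real.enorm_eq_ofReal_abs]

/-- The law of the jump from a random point of `A` to an independent random point of `B`. -/
theorem isAdmissible_map_jump {X : Type*} [MetricSpace X] [MeasurableSpace X] [BorelSpace X]
    [SecondCountableTopology X] {μ : Measure X} {A B : Set X} (hA : MeasurableSet A)
    (hB : MeasurableSet B) (hA0 : μ A ≠ 0) (hB0 : μ B ≠ 0) (hA1 : μ A ≠ ∞) (hB1 : μ B ≠ ∞)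
    {D : ℝ≥0∞} (hD : D ≠ ∞) (hAB : ∀ u ∈ A, ∀ v ∈ B, edist u v ≤ D) :
    IsAdmissible μ (((ProbabilityTheory.cond μ A).prod (ProbabilityTheory.cond μ B)).map
      fun p => TestCurve.jump p.1 p.2) := by
  have := ProbabilityTheory.cond_isProbabilityMeasure_of_finite hA0 hA1
  have := ProbabilityTheory.cond_isProbabilityMeasure_of_finite hB0 hB1
  set ρ := (ProbabilityTheory.cond μ A).prod (ProbabilityTheory.cond μ B) with hρ
  -- Second countability makes the product σ-algebra contain the open sets of `X × X`, so continuity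
  -- suffices.
  have hm : Measurable fun p : X × X => TestCurve.jump p.1 p.2 :=
    TestCurve.continuous_jump.measurable
  have hcond : ∀ E S : Set X, MeasurableSet S →
      ProbabilityTheory.cond μ E S ≤ (μ E)⁻¹ * μ S := by
    intro E S hS
    rw [ProbabilityTheory.cond, Measure.smul_apply, smul_eq_mul]
    gcongr
    exact Measure.restrict_le_self
  refine ⟨Measure.isProbabilityMeasure_map hm.aemeasurable,
    -- The marginal is the normalized restriction to `A` before time 1/2 and to `B` from then on.
    -- The sum of the two constants serves all times.
    ⟨((μ A)⁻¹ + (μ B)⁻¹).toNNReal, fun t S hS => ?_⟩, ?_⟩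
  · have hS' : MeasurableSet S := by rwa [BorelSpace.measurable_eq (α := X)]
    rw [ENNReal.coe_toNNReal (ENNReal.add_ne_top.2 ⟨ENNReal.inv_ne_top.2 hA0,
      ENNReal.inv_ne_top.2 hB0⟩), add_mul]
    rw [show {γ : TestCurve X | γ t ∈ S} = (fun γ : TestCurve X => γ t) ⁻¹' S from rfl,
      Measure.map_apply hm (TestCurve.measurable_eval t hS')]
    rcases lt_or_ge t TestCurve.half with h | h
    · have : (fun p : X × X => TestCurve.jump p.1 p.2) ⁻¹' ((fun γ : TestCurve X => γ t) ⁻¹' S) =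
          S ×ˢ univ := by
        ext p
        simp [TestCurve.jump_of_lt _ _ h]
      rw [this, hρ, Measure.prod_prod, measure_univ, mul_one]
      exact (hcond A S hS').trans le_self_add
    · have : (fun p : X × X => TestCurve.jump p.1 p.2) ⁻¹' ((fun γ : TestCurve X => γ t) ⁻¹' S) =
          univ ×ˢ S := by
        ext p
        simp [TestCurve.jump_of_le _ _ h]
      rw [this, hρ, Measure.prod_prod, measure_univ, one_mul]
      exact (hcond B S hS').trans le_add_self
  · have hae : ∀ᵐ p ∂ρ, p.1 ∈ A ∧ p.2 ∈ B := by
      filter_upwards [Measure.quasiMeasurePreserving_fst.ae (ProbabilityTheory.ae_cond_mem hA),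
        Measure.quasiMeasurePreserving_snd.ae (ProbabilityTheory.ae_cond_mem hB)] with p h1 h2
        using ⟨h1, h2⟩
    calc ∫⁻ γ, γ.variation ∂(ρ.map fun p => TestCurve.jump p.1 p.2)
        -- This inequality for image measures holds without measurability of the variation in `γ`.
        ≤ ∫⁻ p, (TestCurve.jump p.1 p.2).variation ∂ρ := lintegral_map_le _ _
      _ ≤ ∫⁻ _, D ∂ρ := by
          refine lintegral_mono_ae ?_
          filter_upwards [hae] with p hp
          rw [TestCurve.variation_jump]
          exact hAB _ hp.1 _ hp.2
      _ < ∞ := by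
          rw [lintegral_const, measure_univ, mul_one]
          exact hD.lt_top

/-- The upper S-gradient inequality for the random jump between two disjoint sets. -/
theorem IsMeasureUpperSGradient.lintegral_prod_le {X : Type*} [MetricSpace X] [MeasurableSpace X]
    [BorelSpace X] [SecondCountableTopology X] {μ : Measure X} {f : X → EReal} {g : X → ℝ≥0∞}
    (h : IsMeasureUpperSGradient μ f g) {A B : Set X} (hA : MeasurableSet A)
    (hB : MeasurableSet B) (hA0 : μ A ≠ 0) (hB0 : μ B ≠ 0) (hA1 : μ A ≠ ∞) (hB1 : μ B ≠ ∞)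
    (hdisj : Disjoint A B) {D : ℝ≥0∞} (hD : D ≠ ∞) (hAB : ∀ u ∈ A, ∀ v ∈ B, edist u v ≤ D) :
    ∫⁻ p, ‖(f p.2).toReal - (f p.1).toReal‖ₑ
        ∂((ProbabilityTheory.cond μ A).prod (ProbabilityTheory.cond μ B)) ≤
      ∫⁻ p, (g p.1 + g p.2) / 2 * D
        ∂((ProbabilityTheory.cond μ A).prod (ProbabilityTheory.cond μ B)) := by
  have := ProbabilityTheory.cond_isProbabilityMeasure_of_finite hA0 hA1
  have := ProbabilityTheory.cond_isProbabilityMeasure_of_finite hB0 hB1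
  have hP := isAdmissible_map_jump hA hB hA0 hB0 hA1 hB1 hD hAB
  set ρ := (ProbabilityTheory.cond μ A).prod (ProbabilityTheory.cond μ B) with hρ
  have hm : Measurable fun p : X × X => TestCurve.jump p.1 p.2 :=
    TestCurve.continuous_jump.measurable
  obtain ⟨hf, hg, H⟩ := h
  have hf' : Measurable f := by rwa [← BorelSpace.measurable_eq (α := X)] at hf
  have hcA : ProbabilityTheory.cond μ A Aᶜ = 0 := ProbabilityTheory.ae_cond_mem hA
  have hcB : ProbabilityTheory.cond μ B Bᶜ = 0 := ProbabilityTheory.ae_cond_mem hB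
  have hjump0 : ∀ u v : X, TestCurve.jump u v 0 = u := fun u v =>
    TestCurve.jump_of_lt u v TestCurve.half_pos
  have hjump1 : ∀ u v : X, TestCurve.jump u v 1 = v := fun u v =>
    TestCurve.jump_of_le u v TestCurve.half_lt_one.le
  have hvar : ρ.map (fun p => TestCurve.jump p.1 p.2)
      {γ : TestCurve X | γ.variation = 0} = 0 := by
    -- A curve of zero variation has equal end points, so it cannot start in `A` and end in the
    -- disjoint set `B`. The covering event involves only evaluations and is measurable.
    refine measure_mono_null (t := (fun γ : TestCurve X => γ 0) ⁻¹' Aᶜ ∪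
      (fun γ : TestCurve X => γ 1) ⁻¹' Bᶜ) ?_ (measure_union_null ?_ ?_)
    · intro γ hγ
      have h01 : γ 0 = γ 1 :=
        edist_eq_zero.1 ((eVariationOn.eq_zero_iff γ).1 hγ 0 (mem_univ _) 1 (mem_univ _))
      by_contra hcon
      simp only [mem_union, mem_preimage, mem_compl_iff, not_or, not_not] at hcon
      exact disjoint_left.1 hdisj hcon.1 (h01 ▸ hcon.2)
    · rw [Measure.map_apply hm (TestCurve.measurable_eval 0 hA.compl)]
      have : (fun p : X × X => TestCurve.jump p.1 p.2) ⁻¹'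
          ((fun γ : TestCurve X => γ 0) ⁻¹' Aᶜ) = Aᶜ ×ˢ univ := by
        ext p; simp [hjump0]
      rw [this, hρ, Measure.prod_prod, hcA, zero_mul]
    · rw [Measure.map_apply hm (TestCurve.measurable_eval 1 hB.compl)]
      have : (fun p : X × X => TestCurve.jump p.1 p.2) ⁻¹'
          ((fun γ : TestCurve X => γ 1) ⁻¹' Bᶜ) = univ ×ˢ Bᶜ := by
        ext p; simp [hjump1]
      rw [this, hρ, Measure.prod_prod, hcB, mul_zero]
  have hae : ∀ᵐ p ∂ρ, p.1 ∈ A ∧ p.2 ∈ B := by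
    filter_upwards [Measure.quasiMeasurePreserving_fst.ae (ProbabilityTheory.ae_cond_mem hA),
      Measure.quasiMeasurePreserving_snd.ae (ProbabilityTheory.ae_cond_mem hB)] with p h1 h2
      using ⟨h1, h2⟩
  have hmeas : Measurable fun γ : TestCurve X => ‖(f (γ 1)).toReal - (f (γ 0)).toReal‖ₑ :=
    (((measurable_ereal_toReal.comp hf').comp (TestCurve.measurable_eval 1)).sub
      ((measurable_ereal_toReal.comp hf').comp (TestCurve.measurable_eval 0))).enorm
  calc ∫⁻ p, ‖(f p.2).toReal - (f p.1).toReal‖ₑ ∂ρ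
      = ∫⁻ γ : TestCurve X, ‖(f (γ 1)).toReal - (f (γ 0)).toReal‖ₑ
          ∂(ρ.map fun p => TestCurve.jump p.1 p.2) := by
        rw [lintegral_map hmeas hm]
        simp only [hjump0, hjump1]
    _ ≤ ∫⁻ γ : TestCurve X, absDiff (f (γ 1)) (f (γ 0))
          ∂(ρ.map fun p => TestCurve.jump p.1 p.2) :=
        lintegral_mono fun γ => enorm_toReal_sub_le_absDiff _ _
    _ ≤ ∫⁻ γ : TestCurve X, γ.symmIntegral g ∂(ρ.map fun p => TestCurve.jump p.1 p.2) :=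
        H _ hP hvar
    _ ≤ ∫⁻ p, (TestCurve.jump p.1 p.2).symmIntegral g ∂ρ := lintegral_map_le _ _
    _ ≤ ∫⁻ p, (g p.1 + g p.2) / 2 * D ∂ρ := by
        refine lintegral_mono_ae ?_
        filter_upwards [hae] with p hp
        rw [TestCurve.symmIntegral_jump _ _ hg]
        gcongr
        exact hAB _ hp.1 _ hp.2

/-! ### Doubling measures, Lebesgue points and part (b) -/

section Doubling

variable {X : Type*} [MetricSpace X] [MeasurableSpace X] {μ : Measure X}

theorem IsDoublingMeasure.sigmaFinite (hμ : IsDoublingMeasure μ) : SigmaFinite μ := by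
  rcases isEmpty_or_nonempty X with hX | ⟨⟨x₀⟩⟩
  · rw [Measure.eq_zero_of_isEmpty μ]; infer_instance
  refine ⟨⟨⟨fun n : ℕ => Metric.ball x₀ (n + 1), fun _ => trivial,
    fun n => (hμ.1 x₀ _ (by positivity)).2, ?_⟩⟩⟩
  refine eq_univ_of_forall fun x => ?_
  obtain ⟨n, hn⟩ := exists_nat_gt (dist x x₀)
  exact mem_iUnion.2 ⟨n, Metric.mem_ball.2 (by linarith)⟩

theorem IsDoublingMeasure.secondCountableTopology [OpensMeasurableSpace X]
    (hμ : IsDoublingMeasure μ) : SecondCountableTopology X := by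
  have := hμ.sigmaFinite
  refine Metric.secondCountable_of_almost_dense_set fun ε hε => ?_
  -- A maximal `ε`-separated set is an `ε`-net. It is countable, because the balls of radius `ε / 2`
  -- about its points are disjoint and have positive measure for a σ-finite `μ`.
  obtain ⟨N, hN⟩ := zorn_subset {N : Set X | N.Pairwise fun x y => ε ≤ dist x y} fun c hc hchain =>
    ⟨⋃₀ c, (pairwise_sUnion hchain.directedOn).2 hc, fun s hs => subset_sUnion_of_mem hs⟩
  have hdisj : Pairwise (Disjoint on fun i : N => Metric.ball (i : X) (ε / 2)) := by
    intro i j hij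
    refine Metric.ball_disjoint_ball ?_
    have := hN.prop i.2 j.2 (fun h => hij (Subtype.ext h))
    linarith
  have hc := Measure.countable_meas_pos_of_disjoint_iUnion (μ := μ)
    (fun i : N => (Metric.isOpen_ball (x := (i : X)) (ε := ε / 2)).measurableSet) hdisj
  rw [show {i : N | 0 < μ (Metric.ball (i : X) (ε / 2))} = univ from
    eq_univ_of_forall fun i => (hμ.1 i _ (half_pos hε)).1, countable_univ_iff] at hc
  refine ⟨N, hc, fun x => ?_⟩
  by_contra! hx
  have hxN : x ∉ N := fun h => by
    have := hx x h
    rw [dist_self] at this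
    exact absurd this (not_lt.2 hε.le)
  have hins : (insert x N).Pairwise fun x y => ε ≤ dist x y :=
    hN.prop.insert fun y hy _ => ⟨(hx y hy).le, dist_comm x y ▸ (hx y hy).le⟩
  exact hxN (hN.le_of_ge hins (subset_insert x N) (mem_insert x N))

theorem IsDoublingMeasure.measure_closedBall_lt_top (hμ : IsDoublingMeasure μ) (x : X) (r : ℝ) :
    μ (Metric.closedBall x r) < ∞ :=
  (measure_mono (Metric.closedBall_subset_ball (lt_of_le_of_lt (le_abs_self r)
    (lt_add_one |r|)))).trans_lt (hμ.1 x (|r| + 1) (by positivity)).2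

theorem IsDoublingMeasure.measure_closedBall_pos (hμ : IsDoublingMeasure μ) (x : X) {r : ℝ}
    (hr : 0 < r) : 0 < μ (Metric.closedBall x r) :=
  (hμ.1 x r hr).1.trans_le (measure_mono Metric.ball_subset_closedBall)

theorem IsDoublingMeasure.isLocallyFiniteMeasure (hμ : IsDoublingMeasure μ) :
    IsLocallyFiniteMeasure μ :=
  ⟨fun x => ⟨_, Metric.ball_mem_nhds x one_pos, (hμ.1 x 1 one_pos).2⟩⟩

theorem IsDoublingMeasure.isUnifLocDoublingMeasure (hμ : IsDoublingMeasure μ) :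
    IsUnifLocDoublingMeasure μ := by
  obtain ⟨C, hC⟩ := hμ.2
  -- Passing from closed to open balls costs a second doubling.
  refine ⟨⟨C * C, ?_⟩⟩
  filter_upwards [self_mem_nhdsWithin] with r hr x
  have hr : 0 < r := hr
  calc μ (Metric.closedBall x (2 * r)) ≤ μ (Metric.ball x (2 * (2 * r))) :=
        measure_mono (Metric.closedBall_subset_ball (by linarith))
    _ ≤ C * μ (Metric.ball x (2 * r)) := hC x _ (by positivity)
    _ ≤ C * (C * μ (Metric.ball x r)) := by gcongr; exact hC x r hr
    _ ≤ C * (C * μ (Metric.closedBall x r)) := by gcongr; exact Metric.ball_subset_closedBall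
    _ = _ := by rw [ENNReal.coe_mul, mul_assoc]

theorem lintegral_cond {Y : Type*} [MeasurableSpace Y] (μ : Measure Y) (A : Set Y) (h : Y → ℝ≥0∞) :
    ∫⁻ x, h x ∂(ProbabilityTheory.cond μ A) = (∫⁻ x in A, h x ∂μ) / μ A := by
  rw [ProbabilityTheory.cond, lintegral_smul_measure, smul_eq_mul, mul_comm, ENNReal.div_eq_inv_mul,
    mul_comm]

/-- Almost every point is a Lebesgue point with respect to shrinking concentric balls. -/
theorem IsDoublingMeasure.ae_tendsto_lintegral_enorm_sub [BorelSpace X] (hμ : IsDoublingMeasure μ)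
    {F : X → ℝ} (hF : LocallyIntegrable F μ) :
    ∀ᵐ x ∂μ, Tendsto (fun r => ∫⁻ y, ‖F y - F x‖ₑ
      ∂(ProbabilityTheory.cond μ (Metric.closedBall x r))) (𝓝[>] 0) (𝓝 0) := by
  have := hμ.secondCountableTopology
  have := hμ.isLocallyFiniteMeasure
  have := hμ.isUnifLocDoublingMeasure
  filter_upwards [(IsUnifLocDoublingMeasure.vitaliFamily μ 1).ae_tendsto_lintegral_enorm_sub_div hF]
    with x hx
  simp only [lintegral_cond]
  refine hx.comp (IsUnifLocDoublingMeasure.tendsto_closedBall_filterAt μ (fun _ => x) id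
    tendsto_id ?_)
  filter_upwards [self_mem_nhdsWithin] with r hr
  exact Metric.mem_closedBall_self (by rw [one_mul]; exact le_of_lt hr)

theorem locallyIntegrable_of_enorm_le [BorelSpace X] {h : X → ℝ≥0∞} {F : X → ℝ}
    (hh : HasLocallyFiniteIntegral μ h) (hF : Measurable F) (hle : ∀ x, ‖F x‖ₑ ≤ h x) :
    LocallyIntegrable F μ := by
  intro x
  obtain ⟨U, hU, hfin⟩ := hh x
  exact ⟨U, hU, hF.aestronglyMeasurable, (lintegral_mono hle).trans_lt hfin⟩

/-- The upper S-gradient inequality at Lebesgue points. -/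
theorem IsMeasureUpperSGradient.edist_toReal_le [BorelSpace X] [SecondCountableTopology X]
    (hμ : IsDoublingMeasure μ) {f : X → EReal} {g : X → ℝ≥0∞} (h : IsMeasureUpperSGradient μ f g)
    (hg_fin : ∀ᵐ x ∂μ, g x ≠ ∞) {x y : X} (hxy : x ≠ y)
    (hfx : Tendsto (fun r => ∫⁻ u, ‖(f u).toReal - (f x).toReal‖ₑ
      ∂(ProbabilityTheory.cond μ (Metric.closedBall x r))) (𝓝[>] 0) (𝓝 0))
    (hfy : Tendsto (fun r => ∫⁻ u, ‖(f u).toReal - (f y).toReal‖ₑ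
      ∂(ProbabilityTheory.cond μ (Metric.closedBall y r))) (𝓝[>] 0) (𝓝 0))
    (hgx : Tendsto (fun r => ∫⁻ u, ‖(g u).toReal - (g x).toReal‖ₑ
      ∂(ProbabilityTheory.cond μ (Metric.closedBall x r))) (𝓝[>] 0) (𝓝 0))
    (hgy : Tendsto (fun r => ∫⁻ u, ‖(g u).toReal - (g y).toReal‖ₑ
      ∂(ProbabilityTheory.cond μ (Metric.closedBall y r))) (𝓝[>] 0) (𝓝 0)) :
    ‖(f y).toReal - (f x).toReal‖ₑ ≤ (g x / 2 + g y / 2) * edist x y := by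
  have hf' : Measurable fun u => (f u).toReal := by
    have := h.1
    rw [← BorelSpace.measurable_eq (α := X)] at this
    exact measurable_ereal_toReal.comp this
  have hg' : Measurable g := by
    have := h.2.1
    rwa [← BorelSpace.measurable_eq (α := X)] at this
  set α : X → ℝ → ℝ≥0∞ := fun z r => ∫⁻ u, ‖(f u).toReal - (f z).toReal‖ₑ
      ∂(ProbabilityTheory.cond μ (Metric.closedBall z r)) with hα
  set β : X → ℝ → ℝ≥0∞ := fun z r => ∫⁻ u, ‖(g u).toReal - (g z).toReal‖ₑ
      ∂(ProbabilityTheory.cond μ (Metric.closedBall z r)) with hβ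
  have hd : 0 < dist x y := dist_pos.2 hxy
  -- The condition on `r` makes the balls disjoint. Points of the two balls are at most `d(x, y) + 2
  -- * r` apart, and `α`, `β` measure the mean oscillation of `f` and `g` about their values at the
  -- centres.
  have key : ∀ r : ℝ, 0 < r → 2 * r < dist x y → ‖(f y).toReal - (f x).toReal‖ₑ ≤
      α x r + α y r + ((g x + β x r) / 2 + (g y + β y r) / 2) *
        (edist x y + ENNReal.ofReal (2 * r)) := by
    intro r hr hr2
    set A := Metric.closedBall x r
    set B := Metric.closedBall y r
    have hA0 : μ A ≠ 0 := (hμ.measure_closedBall_pos x hr).ne'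
    have hB0 : μ B ≠ 0 := (hμ.measure_closedBall_pos y hr).ne'
    have hA1 : μ A ≠ ∞ := (hμ.measure_closedBall_lt_top x r).ne
    have hB1 : μ B ≠ ∞ := (hμ.measure_closedBall_lt_top y r).ne
    have := ProbabilityTheory.cond_isProbabilityMeasure_of_finite hA0 hA1
    have := ProbabilityTheory.cond_isProbabilityMeasure_of_finite hB0 hB1
    have hdisj : Disjoint A B := Metric.closedBall_disjoint_closedBall (by linarith)
    set D : ℝ≥0∞ := edist x y + ENNReal.ofReal (2 * r) with hDdef
    have hD : D ≠ ∞ := ENNReal.add_ne_top.2 ⟨edist_ne_top _ _, ENNReal.ofReal_ne_top⟩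
    have hAB : ∀ u ∈ A, ∀ v ∈ B, edist u v ≤ D := by
      intro u hu v hv
      rw [hDdef, edist_dist, edist_dist, ← ENNReal.ofReal_add dist_nonneg (by positivity)]
      refine ENNReal.ofReal_le_ofReal ?_
      have h1 : dist u x ≤ r := hu
      have h2 : dist v y ≤ r := hv
      have h3 := dist_triangle4 u x y v
      rw [dist_comm y v] at h3
      linarith
    have main := h.lintegral_prod_le measurableSet_closedBall measurableSet_closedBall
      hA0 hB0 hA1 hB1 hdisj hD hAB
    set ρ := (ProbabilityTheory.cond μ A).prod (ProbabilityTheory.cond μ B) with hρ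
    have hfst : ∀ k : X → ℝ≥0∞, Measurable k →
        ∫⁻ p, k p.1 ∂ρ = ∫⁻ u, k u ∂(ProbabilityTheory.cond μ A) := fun k hk =>
      measurePreserving_fst.lintegral_comp hk
    have hsnd : ∀ k : X → ℝ≥0∞, Measurable k →
        ∫⁻ p, k p.2 ∂ρ = ∫⁻ u, k u ∂(ProbabilityTheory.cond μ B) := fun k hk =>
      measurePreserving_snd.lintegral_comp hk
    have hm : ∀ z, Measurable fun u => ‖(f u).toReal - (f z).toReal‖ₑ := fun z =>
      (hf'.sub_const _).enorm
    have hgavg : ∀ z : X, ∀ S : Set X, ∀ _ : IsProbabilityMeasure (ProbabilityTheory.cond μ S),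
        ∫⁻ u, g u ∂(ProbabilityTheory.cond μ S) ≤
          g z + ∫⁻ u, ‖(g u).toReal - (g z).toReal‖ₑ ∂(ProbabilityTheory.cond μ S) := by
      intro z S hS
      rw [show g z + ∫⁻ u, ‖(g u).toReal - (g z).toReal‖ₑ ∂(ProbabilityTheory.cond μ S) =
        ∫⁻ u, (g z + ‖(g u).toReal - (g z).toReal‖ₑ) ∂(ProbabilityTheory.cond μ S) by
          rw [lintegral_add_left measurable_const, lintegral_const, measure_univ, mul_one]]
      refine lintegral_mono_ae ?_
      filter_upwards [ProbabilityTheory.cond_absolutelyContinuous.ae_le hg_fin] with u hu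
      calc g u = ‖(g u).toReal‖ₑ := by
            rw [Real.enorm_eq_ofReal ENNReal.toReal_nonneg, ENNReal.ofReal_toReal hu]
        _ = ‖(g z).toReal + ((g u).toReal - (g z).toReal)‖ₑ := by rw [add_sub_cancel]
        _ ≤ ‖(g z).toReal‖ₑ + ‖(g u).toReal - (g z).toReal‖ₑ := enorm_add_le _ _
        _ ≤ _ := by
            gcongr
            rw [Real.enorm_eq_ofReal ENNReal.toReal_nonneg]
            exact ENNReal.ofReal_toReal_le
    calc ‖(f y).toReal - (f x).toReal‖ₑ = ∫⁻ _, ‖(f y).toReal - (f x).toReal‖ₑ ∂ρ := by simp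
      _ ≤ ∫⁻ p, (‖(f p.1).toReal - (f x).toReal‖ₑ + ‖(f p.2).toReal - (f y).toReal‖ₑ +
            ‖(f p.2).toReal - (f p.1).toReal‖ₑ) ∂ρ := by
          refine lintegral_mono fun p => ?_
          have : (f y).toReal - (f x).toReal = ((f p.1).toReal - (f x).toReal) +
            -((f p.2).toReal - (f y).toReal) + ((f p.2).toReal - (f p.1).toReal) := by ring
          rw [this]
          refine (enorm_add_le _ _).trans ?_
          gcongr
          refine (enorm_add_le _ _).trans ?_
          rw [enorm_neg]
      _ = α x r + α y r + ∫⁻ p, ‖(f p.2).toReal - (f p.1).toReal‖ₑ ∂ρ := by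
          have hm1 : Measurable fun p : X × X => ‖(f p.1).toReal - (f x).toReal‖ₑ :=
            (hm x).comp measurable_fst
          have hm2 : Measurable fun p : X × X => ‖(f p.2).toReal - (f y).toReal‖ₑ :=
            (hm y).comp measurable_snd
          have hm12 : Measurable fun p : X × X =>
            ‖(f p.1).toReal - (f x).toReal‖ₑ + ‖(f p.2).toReal - (f y).toReal‖ₑ := hm1.add hm2
          rw [lintegral_add_left hm12, lintegral_add_left hm1, hfst _ (hm x),
            hsnd _ (hm y)]
      _ ≤ α x r + α y r + ∫⁻ p, (g p.1 + g p.2) / 2 * D ∂ρ := by gcongr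
      _ = α x r + α y r + ((∫⁻ u, g u ∂(ProbabilityTheory.cond μ A)) / 2 +
            (∫⁻ u, g u ∂(ProbabilityTheory.cond μ B)) / 2) * D := by
          have hm1 : Measurable fun p : X × X => g p.1 := hg'.comp measurable_fst
          rw [lintegral_mul_const' _ _ hD]
          simp only [div_eq_mul_inv]
          rw [lintegral_mul_const' _ _ (by simp), lintegral_add_left hm1,
            hfst g hg', hsnd g hg', add_mul]
      _ ≤ _ := by
          gcongr
          · exact hgavg x A inferInstance
          · exact hgavg y B inferInstance
  -- An infinite value makes the right side infinite, as `x ≠ y`. Otherwise both factors have finite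
  -- limits and the product converges.
  by_cases hgfin : g x = ∞ ∨ g y = ∞
  · have hd' : edist x y ≠ 0 := by simpa [edist_eq_zero] using hxy
    rcases hgfin with hg1 | hg1 <;>
      simp [hg1, ENNReal.top_div_of_ne_top ENNReal.ofNat_ne_top, ENNReal.top_mul hd']
  push Not at hgfin
  have hlim : Tendsto (fun r => α x r + α y r + ((g x + β x r) / 2 + (g y + β y r) / 2) *
        (edist x y + ENNReal.ofReal (2 * r))) (𝓝[>] 0)
      (𝓝 (0 + 0 + ((g x + 0) / 2 + (g y + 0) / 2) * (edist x y + 0))) := by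
    have h1 : Tendsto (fun r : ℝ => ENNReal.ofReal (2 * r)) (𝓝[>] 0) (𝓝 0) := by
      have : Tendsto (fun r : ℝ => 2 * r) (𝓝[>] 0) (𝓝 (2 * 0)) :=
        ((continuous_const_mul (2 : ℝ)).tendsto 0).mono_left nhdsWithin_le_nhds
      simpa using ENNReal.tendsto_ofReal this
    have hhalf : ∀ (z : X), Tendsto (β z) (𝓝[>] 0) (𝓝 0) →
        Tendsto (fun r => (g z + β z r) / 2) (𝓝[>] 0) (𝓝 ((g z + 0) / 2)) := fun z hz =>
      ENNReal.Tendsto.div_const (tendsto_const_nhds.add hz) (Or.inr two_ne_zero)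
    refine (hfx.add hfy).add (ENNReal.Tendsto.mul ((hhalf x hgx).add (hhalf y hgy)) (Or.inr ?_)
      (tendsto_const_nhds.add h1) (Or.inr ?_))
    · rw [add_zero]; exact edist_ne_top _ _
    · rw [add_zero, add_zero]
      exact ENNReal.add_ne_top.2 ⟨ENNReal.div_ne_top hgfin.1 two_ne_zero,
        ENNReal.div_ne_top hgfin.2 two_ne_zero⟩
  simp only [add_zero, zero_add] at hlim
  refine ge_of_tendsto hlim ?_
  filter_upwards [Ioo_mem_nhdsGT (half_pos hd)] with r hr
  exact key r hr.1 (by linarith [hr.2])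

theorem IsMeasureUpperSGradient.isHajlaszGradient [BorelSpace X] (hμ : IsDoublingMeasure μ)
    {f : X → EReal} {g : X → ℝ≥0∞} (hf_fin : ∀ᵐ x ∂μ, f x ≠ ⊤ ∧ f x ≠ ⊥)
    (hg_fin : ∀ᵐ x ∂μ, g x ≠ ∞) (hfloc : HasLocallyFiniteIntegral μ fun x => (f x).abs)
    (hgloc : HasLocallyFiniteIntegral μ g) (h : IsMeasureUpperSGradient μ f g) :
    IsHajlaszGradient μ f fun x => g x / 2 := by
  have := hμ.secondCountableTopology
  have hf' : Measurable f := by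
    have := h.1
    rwa [← BorelSpace.measurable_eq (α := X)] at this
  have hg' : Measurable g := by
    have := h.2.1
    rwa [← BorelSpace.measurable_eq (α := X)] at this
  have hF : LocallyIntegrable (fun x => (f x).toReal) μ :=
    locallyIntegrable_of_enorm_le hfloc (measurable_ereal_toReal.comp hf') fun x => by
      have := enorm_toReal_sub_le_absDiff (f x) 0
      simpa [absDiff] using this
  have hG : LocallyIntegrable (fun x => (g x).toReal) μ :=
    locallyIntegrable_of_enorm_le hgloc (ENNReal.measurable_toReal.comp hg') fun x => by
      rw [Real.enorm_eq_ofReal ENNReal.toReal_nonneg]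
      exact ENNReal.ofReal_toReal_le
  have hall := (hf_fin.and (hμ.ae_tendsto_lintegral_enorm_sub hF)).and
    (hμ.ae_tendsto_lintegral_enorm_sub hG)
  obtain ⟨E, hNE, hE, hE0⟩ := exists_measurable_superset_of_null (ae_iff.1 hall)
  refine ⟨hf', hf_fin, hg'.div_const 2, E, hE, hE0, fun x hx y hy => ?_⟩
  obtain ⟨⟨hx1, hx2⟩, hx3⟩ := by_contra fun hcon => hx (hNE hcon)
  obtain ⟨⟨hy1, hy2⟩, hy3⟩ := by_contra fun hcon => hy (hNE hcon)
  rw [← EReal.coe_toReal hx1.1 hx1.2, ← EReal.coe_toReal hy1.1 hy1.2, absDiff_coe,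
    ← Real.enorm_eq_ofReal_abs]
  rcases eq_or_ne x y with rfl | hxy
  · simp
  exact h.edist_toReal_le hμ hg_fin hxy hx2 hy2 hx3 hy3

end Doubling

/-! ### Restriction to the Borel σ-algebra -/

section Trim

variable {X : Type*} [MetricSpace X] [MeasurableSpace X] [OpensMeasurableSpace X] {μ : Measure X}

theorem IsDoublingMeasure.trim_borel (hμ : IsDoublingMeasure μ) :
    @IsDoublingMeasure X _ (borel X) (μ.trim OpensMeasurableSpace.borel_le) := by
  have hball : ∀ (x : X) (r : ℝ), μ.trim OpensMeasurableSpace.borel_le (Metric.ball x r) =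
      μ (Metric.ball x r) := fun x r =>
    trim_measurableSet_eq _ (MeasurableSpace.measurableSet_generateFrom Metric.isOpen_ball)
  unfold IsDoublingMeasure
  simp only [hball]
  exact hμ

theorem HasLocallyFiniteIntegral.trim_borel {h : X → ℝ≥0∞} (hh : Measurable[borel X] h)
    (hloc : HasLocallyFiniteIntegral μ h) :
    @HasLocallyFiniteIntegral X _ (borel X) (μ.trim OpensMeasurableSpace.borel_le) h := by
  intro x
  obtain ⟨U, hU, hfin⟩ := hloc x
  have ho : MeasurableSet[borel X] (interior U) :=
    MeasurableSpace.measurableSet_generateFrom isOpen_interior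
  -- The neighbourhood need not be Borel; its interior is.
  refine ⟨interior U, interior_mem_nhds.2 hU, ?_⟩
  rw [restrict_trim _ _ ho, lintegral_trim _ hh]
  exact (lintegral_mono_set interior_subset).trans_lt hfin

theorem IsMeasureUpperSGradient.trim_borel {f : X → EReal} {g : X → ℝ≥0∞}
    (h : IsMeasureUpperSGradient μ f g) :
    @IsMeasureUpperSGradient X _ (borel X) (μ.trim OpensMeasurableSpace.borel_le) f g := by
  refine ⟨h.1, h.2.1, fun P hP => h.2.2 P ?_⟩
  obtain ⟨h1, ⟨C, hC⟩, h2⟩ := hP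
  exact ⟨h1, ⟨C, fun t B hB => (hC t B hB).trans_eq (by rw [trim_measurableSet_eq _ hB])⟩, h2⟩

theorem ae_trim_borel {p : X → Prop} (hp : MeasurableSet[borel X] {x | p x})
    (h : ∀ᵐ x ∂μ, p x) :
    ∀ᵐ x ∂(μ.trim OpensMeasurableSpace.borel_le : @Measure X (borel X)), p x := by
  rw [ae_iff] at h ⊢
  change μ.trim OpensMeasurableSpace.borel_le {x | p x}ᶜ = 0
  rw [trim_measurableSet_eq _ (@MeasurableSet.compl X _ (borel X) hp)]
  exact h

end Trim

theorem EReal.abs_eq_toENNReal_max (a : EReal) : a.abs = (max a (-a)).toENNReal := by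
  induction a with
  | bot => simp
  | top => simp
  | coe a =>
    rw [EReal.abs_def, ← EReal.coe_neg, ← EReal.coe_strictMono.monotone.map_max,
      EReal.toENNReal_of_ne_top (EReal.coe_ne_top _)]
    rfl

theorem mainTheorem4 {X : Type*} [MetricSpace X] [MeasurableSpace X] [OpensMeasurableSpace X]
    (μ : Measure X) (hμ : IsBorelRegular μ)
    (f : X → EReal) (g : X → ℝ≥0∞) (hf : Measurable f) (hg : Measurable g)
    (hf_fin : ∀ᵐ x ∂μ, f x ≠ ⊤ ∧ f x ≠ ⊥) (hg_fin : ∀ᵐ x ∂μ, g x ≠ ∞) :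
    (SigmaFinite μ → IsHajlaszGradient μ f g →
      ∃ (f' : X → ℝ) (g' : X → ℝ≥0∞), Measurable[borel X] f' ∧ Measurable[borel X] g' ∧
        (∀ᵐ x ∂μ, f x = (f' x : EReal)) ∧ (∀ᵐ x ∂μ, g x = g' x) ∧
        IsMeasureUpperSGradient μ (fun x => (f' x : EReal)) (fun x => 76 * g' x)) ∧
    (IsDoublingMeasure μ → Measurable[borel X] f → Measurable[borel X] g →
      HasLocallyFiniteIntegral μ (fun x => (f x).abs) → HasLocallyFiniteIntegral μ g →
      IsMeasureUpperSGradient μ f g →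
      IsHajlaszGradient μ f (fun x => g x / 2)) := by
  refine ⟨fun _ h => ?_, fun hd hfB hgB hfloc hgloc h => ?_⟩
  · obtain ⟨f', g', hf', hg', hff', hgg', ⟨B, hB, hB0, hgB⟩, hfg⟩ := h.exists_borel hμ hg_fin
    exact ⟨f', g', hf', hg', hff', hgg',
      isMeasureUpperSGradient_of_edist_le hf' hg' hB hB0 hgB hfg (by norm_num)⟩
  -- The Lebesgue point argument uses a measure on the Borel σ-algebra, so all data pass to the
  -- restricted measure. Integrals are unchanged for Borel integrands, which is why `|f|` must be
  -- Borel.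
  · have habs : Measurable[borel X] fun x => (f x).abs := by
      have : (fun x => (f x).abs) = fun x => (max (f x) (-f x)).toENNReal := by
        ext x
        exact EReal.abs_eq_toENNReal_max (f x)
      rw [this]
      exact (measurable_ereal_toENNReal.comp (measurable_id.max measurable_neg)).comp hfB
    have hS : MeasurableSet[borel X] {x | f x ≠ ⊤ ∧ f x ≠ ⊥} :=
      hfB ((measurableSet_singleton ⊤).compl.inter (measurableSet_singleton ⊥).compl)
    have hT : MeasurableSet[borel X] {x | g x ≠ ∞} := hgB (measurableSet_singleton ∞).compl
    obtain ⟨-, -, -, E, hE, hE0, hEfg⟩ := @IsMeasureUpperSGradient.isHajlaszGradient X _ (borel X)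
      _ (@BorelSpace.mk X _ (borel X) rfl) hd.trim_borel f g
      (ae_trim_borel hS hf_fin) (ae_trim_borel hT hg_fin)
      (hfloc.trim_borel habs) (hgloc.trim_borel hgB) h.trim_borel
    exact ⟨hf, hf_fin, hg.div_const 2, E, OpensMeasurableSpace.borel_le _ hE,
      by rwa [trim_measurableSet_eq _ hE] at hE0, hEfg⟩
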